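/- Let $T$ be a tetrahedron with vertices $1,2,3,4$. The double tetrahedron $\mathrm{DT}$ is the triangulation of $S^3$ obtained by identifying the corresponding boundary faces of two disjoint copies of $T$. A metric on $\mathrm{DT}$ is a vector $\ell=(\ell_{12},\ell_{13},\ell_{14},\ell_{23},\ell_{24},\ell_{34})\in\mathbb R^6$ of edge lengths of a nondegenerate Euclidean tetrahedron; $\mathfrak{met}$ denotes the set of metrics. For $\ell\in\mathfrak{met}$ let $\beta_e$ be the dihedral angle of this tetrahedron at the edge $e$, let $\mathcal V$ be twice its volume, and put $$K_e=(2\pi-2\beta_e)\,\ell_e,\qquad \mathcal L=\sum_e\ell_e,\qquad \mathcal{EHR}=\sum_e K_e,\qquad \mathcal{LEHR}=\frac{\mathcal{EHR}}{\mathcal L},\qquad \mathcal{VEHR}=\frac{\mathcal{EHR}}{\mathcal V^{1/3}}.$$ A metric is $\mathcal L$-Einstein if there is $\lambda\in\mathbb R$ with $K_e=\lambda\ell_e$ for all edges $e$, and $\mathcal V$-Einstein if there is $\lambda\in\mathbb R$ with $K_e=\lambda\,\ell_e\,\partial\mathcal V/\partial\ell_e$ for all edges $e$. A saddle point is a critical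 point that is neither a local minimum nor a local maximum. For $k>0$ let $\ell_k=(k,k,k,k,k,k)$ be the equal length metric with edge length $k$. 1. For every $k>0$, $\ell_k$ is a metric that is both $\mathcal L$-Einstein and $\mathcal V$-Einstein. 2. For every $k>0$, both functionals are of class $C^2$ at $\ell_k$, and their Hessian matrices at $\ell_k$ both have the eigenspaces $$V_{\lambda_1}=\operatorname{span}\{(1,0,0,0,0,-1),\,(0,1,0,0,-1,0),\,(0,0,1,-1,0,0)\},$$ $$V_{\lambda_2}=\operatorname{span}\{(0,1,-1,-1,1,0),\,(1,-\tfrac12,-\tfrac12,-\tfrac12,-\tfrac12,1)\},\qquad V_0=\operatorname{span}\{(1,1,1,1,1,1)\},$$ of dimensions $3$, $2$, $1$, for the eigenvalues $\lambda_1$, $\lambda_2$, $0$ respectively, and no other eigenvalues, where $$\lambda_1^{\mathcal{LEHR}}=\frac{2\sqrt2}{9}k^{-2},\qquad \lambda_2^{\mathcal{LEHR}}=-\frac{2\sqrt2}{3}k^{-2},$$ $$\lambda_1^{\mathcal{VEHR}}=2^{7/6}\,3^{-2/3}\,k^{-2}\left(2^{3/2}+9\pi-9\arccos\tfrac13\right),\qquad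 \lambda_2^{\mathcal{VEHR}}=2^{7/6}\,3^{1/3}\,k^{-2}\left(7\pi-2^{3/2}-7\arccos\tfrac13\right).$$ 3. The critical points of $\mathcal{LEHR}$ on $\mathfrak{met}$ are exactly the equal length metrics $\ell_k$, $k>0$; these are also exactly the $\mathcal L$-Einstein metrics, and each of them is a saddle point of $\mathcal{LEHR}$. 4. For every $k>0$, $\ell_k$ is a local minimum of $\mathcal{VEHR}$ on $\mathfrak{met}$. -/

import Mathlib

noncomputable section

namespace DoubleTetrahedron

/-- The vertices of the generating tetrahedron are `0, 1, 2, 3` (the vertices 1, 2, 3, 4), and its six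
edges are indexed by `Fin 6` in the order 12, 13, 14, 23, 24, 34. -/
def edgeEnds : Fin 6 → Fin 4 × Fin 4 :=
  ![(0, 1), (0, 2), (0, 3), (1, 2), (1, 3), (2, 3)]

/-- The index of the edge joining two distinct vertices (the diagonal entries are never used). -/
def edgeIndex : Fin 4 → Fin 4 → Fin 6 :=
  ![![0, 0, 1, 2],
    ![0, 0, 3, 4],
    ![1, 3, 0, 5],
    ![2, 4, 5, 0]]

/-- The distance between the vertices `i` and `j` prescribed by the edge lengths `ℓ`. -/
def len (ℓ : Fin 6 → ℝ) (i j : Fin 4) : ℝ :=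
  if i = j then 0 else ℓ (edgeIndex i j)

/-- The space of metrics on the double tetrahedron: the vectors of edge lengths that are realized
by a nondegenerate Euclidean tetrahedron. -/
def met : Set (Fin 6 → ℝ) :=
  {ℓ | ∃ p : Fin 4 → EuclideanSpace ℝ (Fin 3), AffineIndependent ℝ p ∧
    ∀ e, dist (p (edgeEnds e).1) (p (edgeEnds e).2) = ℓ e}

/-- The Cayley-Menger determinant of the generating tetrahedron. -/
def cayleyMenger (ℓ : Fin 6 → ℝ) : ℝ :=
  Matrix.det !![0, 1, 1, 1, 1;
                1, 0, ℓ 0 ^ 2, ℓ 1 ^ 2, ℓ 2 ^ 2;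
                1, ℓ 0 ^ 2, 0, ℓ 3 ^ 2, ℓ 4 ^ 2;
                1, ℓ 1 ^ 2, ℓ 3 ^ 2, 0, ℓ 5 ^ 2;
                1, ℓ 2 ^ 2, ℓ 4 ^ 2, ℓ 5 ^ 2, 0]

/-- The volume of the generating tetrahedron. -/
def tetVolume (ℓ : Fin 6 → ℝ) : ℝ :=
  Real.sqrt (cayleyMenger ℓ / 288)

/-- The angle at the vertex `i` of the face `i j k`, by the Euclidean cosine law. -/
def faceAngle (ℓ : Fin 6 → ℝ) (i j k : Fin 4) : ℝ :=
  Real.arccos ((len ℓ i j ^ 2 + len ℓ i k ^ 2 - len ℓ j k ^ 2) / (2 * len ℓ i j * len ℓ i k))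

/-- The dihedral angle at the edge `i j` of the tetrahedron `i j k l`: the angle at the point
in the direction of `j` of the spherical triangle cut out at the vertex `i`, by the spherical cosine law. -/
def dihedralAt (ℓ : Fin 6 → ℝ) (i j k l : Fin 4) : ℝ :=
  Real.arccos
    ((Real.cos (faceAngle ℓ i k l) - Real.cos (faceAngle ℓ i j k) * Real.cos (faceAngle ℓ i j l)) /
      (Real.sin (faceAngle ℓ i j k) * Real.sin (faceAngle ℓ i j l)))

/-- The dihedral angle of the generating tetrahedron at the edge `e`. The edge opposite to `e`
is `e.rev`. -/
def dihedral (ℓ : Fin 6 → ℝ) (e : Fin 6) : ℝ :=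
  dihedralAt ℓ (edgeEnds e).1 (edgeEnds e).2 (edgeEnds e.rev).1 (edgeEnds e.rev).2

/-- The edge curvature `K_e = (2π - ∑_t β_{e<t}) ℓ_e`; every edge of the double tetrahedron lies in
its two (congruent) tetrahedra. -/
def edgeCurvature (ℓ : Fin 6 → ℝ) (e : Fin 6) : ℝ :=
  (2 * Real.pi - ∑ _t : Fin 2, dihedral ℓ e) * ℓ e

/-- The total length. -/
def totalLength (ℓ : Fin 6 → ℝ) : ℝ := ∑ e, ℓ e

/-- The volume of the double tetrahedron, the sum over its two tetrahedra. -/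
def volume (ℓ : Fin 6 → ℝ) : ℝ := ∑ _t : Fin 2, tetVolume ℓ

/-- The Einstein-Hilbert-Regge functional. -/
def EHR (ℓ : Fin 6 → ℝ) : ℝ := ∑ e, edgeCurvature ℓ e

/-- The length normalized Einstein-Hilbert-Regge functional. -/
def LEHR (ℓ : Fin 6 → ℝ) : ℝ := EHR ℓ / totalLength ℓ

/-- The volume normalized Einstein-Hilbert-Regge functional. -/
def VEHR (ℓ : Fin 6 → ℝ) : ℝ := EHR ℓ / volume ℓ ^ (1 / 3 : ℝ)

/-- The partial derivative `∂F/∂ℓ_e`. -/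
def partialDeriv (F : (Fin 6 → ℝ) → ℝ) (e : Fin 6) (ℓ : Fin 6 → ℝ) : ℝ :=
  fderiv ℝ F ℓ (Pi.single e 1)

/-- The Hessian matrix of second partial derivatives. -/
def hessian (F : (Fin 6 → ℝ) → ℝ) (ℓ : Fin 6 → ℝ) : Matrix (Fin 6) (Fin 6) ℝ :=
  Matrix.of fun e e' => partialDeriv (partialDeriv F e') e ℓ

/-- `𝓛`-Einstein metrics: `K_e = λ ℓ_e` for all edges `e`. -/
def IsLEinstein (ℓ : Fin 6 → ℝ) : Prop :=
  ℓ ∈ met ∧ ∃ c : ℝ, ∀ e, edgeCurvature ℓ e = c * ℓ e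

/-- `𝓥`-Einstein metrics: `K_e = λ V_e` for all edges `e`, where `V_e = ℓ_e ∂𝓥/∂ℓ_e`. -/
def IsVEinstein (ℓ : Fin 6 → ℝ) : Prop :=
  ℓ ∈ met ∧ ∃ c : ℝ, ∀ e, edgeCurvature ℓ e = c * (ℓ e * partialDeriv volume e ℓ)

/-- The metric is a critical point of the functional `F`: its differential exists and vanishes there. -/
def IsCritical (F : (Fin 6 → ℝ) → ℝ) (ℓ : Fin 6 → ℝ) : Prop :=
  ℓ ∈ met ∧ HasFDerivAt F (0 : (Fin 6 → ℝ) →L[ℝ] ℝ) ℓ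

/-- A saddle point on the space of metrics: a critical point that is neither a local minimum nor
a local maximum. -/
def IsSaddle (F : (Fin 6 → ℝ) → ℝ) (ℓ : Fin 6 → ℝ) : Prop :=
  IsCritical F ℓ ∧ ¬ IsLocalMinOn F met ℓ ∧ ¬ IsLocalMaxOn F met ℓ

/-- The metric all of whose edge lengths are `k`. -/
def equalLength (k : ℝ) : Fin 6 → ℝ := fun _ => k

/-- The three-dimensional subspace `V_{λ₁}`. -/
def V₁ : Submodule ℝ (Fin 6 → ℝ) :=
  Submodule.span ℝ {![1, 0, 0, 0, 0, -1], ![0, 1, 0, 0, -1, 0], ![0, 0, 1, -1, 0, 0]}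

/-- The two-dimensional subspace `V_{λ₂}`. -/
def V₂ : Submodule ℝ (Fin 6 → ℝ) :=
  Submodule.span ℝ {![0, 1, -1, -1, 1, 0], ![1, -1 / 2, -1 / 2, -1 / 2, -1 / 2, 1]}

/-- The line `V₀` of scaling directions. -/
def V₀ : Submodule ℝ (Fin 6 → ℝ) :=
  Submodule.span ℝ {![1, 1, 1, 1, 1, 1]}

/-- `F` is twice continuously differentiable at `ℓ`, and its Hessian matrix there has exactly the
eigenvalues `a`, `b`, `0`, with the eigenspaces `V₁`, `V₂`, `V₀` of dimensions 3, 2, 1. -/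
def HasHessianEigendata (F : (Fin 6 → ℝ) → ℝ) (ℓ : Fin 6 → ℝ) (a b : ℝ) : Prop :=
  ContDiffAt ℝ 2 F ℓ ∧
  Module.End.eigenspace (Matrix.toLin' (hessian F ℓ)) a = V₁ ∧ Module.finrank ℝ V₁ = 3 ∧
  Module.End.eigenspace (Matrix.toLin' (hessian F ℓ)) b = V₂ ∧ Module.finrank ℝ V₂ = 2 ∧
  Module.End.eigenspace (Matrix.toLin' (hessian F ℓ)) 0 = V₀ ∧ Module.finrank ℝ V₀ = 1 ∧
  ∀ μ : ℝ, Module.End.HasEigenvalue (Matrix.toLin' (hessian F ℓ)) μ ↔ μ = a ∨ μ = b ∨ μ = 0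

end DoubleTetrahedron

end

noncomputable section

namespace DoubleTetrahedron

open scoped Topology

/-! Write H_v for 16 times the squared area of the face opposite v, Q_e for `cosNumer`, and D for
the Cayley-Menger determinant. On metrics cos β_e = Q_e / √(H H'), where H and H' belong to the two
faces meeting at e. The geometry then rests on two polynomial identities: H_v is the sum of Q_e over
the edges of its face (`faceHeron_eq_sum`), and H H' - Q_e² = 2 ℓ_e² D
(`faceHeron_mul_faceHeron_sub`). Together they yield the Schläfli formula, so dEHR = ∑ (2π - 2β_e)
dℓ_e.

Both the 𝓛-Einstein condition and criticality for LEHR therefore say that all six dihedral angles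
agree, and `eq_equalLength_of_dihedral_eq` shows that this happens only for regular tetrahedra.

At ℓ_k both Hessians have the form p J + q I + r P, with J the all-ones matrix and P the exchange of
opposite edges; `HasSecondOrder` records p, q, r. Such a matrix acts by q - r on vectors odd under
P, by q + r on even vectors of sum zero, and by 6p + q + r = 0 on constants. For LEHR the two
nonzero eigenvalues have opposite signs, which gives a saddle. For VEHR both are positive, and the
remaining null direction is harmless because VEHR is scale invariant. -/

/-! ### Dihedral angles through face areas and the Cayley-Menger determinant -/

/-- `16` times the squared area of the face `i j k`. -/
def heron (ℓ : Fin 6 → ℝ) (i j k : Fin 4) : ℝ :=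
  4 * len ℓ i j ^ 2 * len ℓ i k ^ 2 - (len ℓ i j ^ 2 + len ℓ i k ^ 2 - len ℓ j k ^ 2) ^ 2

/-- The numerator of the cosine of the dihedral angle at the edge `i j`. -/
def cosNumerAt (ℓ : Fin 6 → ℝ) (i j k l : Fin 4) : ℝ :=
  2 * len ℓ i j ^ 2 * (len ℓ i k ^ 2 + len ℓ i l ^ 2 - len ℓ k l ^ 2) -
    (len ℓ i j ^ 2 + len ℓ i k ^ 2 - len ℓ j k ^ 2) *
      (len ℓ i j ^ 2 + len ℓ i l ^ 2 - len ℓ j l ^ 2)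

/-- The numerator of the cosine of the dihedral angle at the edge `e`. -/
def cosNumer (e : Fin 6) (ℓ : Fin 6 → ℝ) : ℝ :=
  cosNumerAt ℓ (edgeEnds e).1 (edgeEnds e).2 (edgeEnds e.rev).1 (edgeEnds e.rev).2

/-- `16` times the squared area of the face opposite to a vertex. -/
def faceHeron (v : Fin 4) (ℓ : Fin 6 → ℝ) : ℝ :=
  ![heron ℓ 1 2 3, heron ℓ 0 2 3, heron ℓ 0 1 3, heron ℓ 0 1 2] v

theorem cos_sin_arccos_cosineLaw {a b d : ℝ} (ha : 0 < a) (hb : 0 < b)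
    (h : 0 ≤ 4 * a ^ 2 * b ^ 2 - (a ^ 2 + b ^ 2 - d ^ 2) ^ 2) :
    Real.cos (Real.arccos ((a ^ 2 + b ^ 2 - d ^ 2) / (2 * a * b))) =
        (a ^ 2 + b ^ 2 - d ^ 2) / (2 * a * b) ∧
      Real.sin (Real.arccos ((a ^ 2 + b ^ 2 - d ^ 2) / (2 * a * b))) =
        Real.sqrt (4 * a ^ 2 * b ^ 2 - (a ^ 2 + b ^ 2 - d ^ 2) ^ 2) / (2 * a * b) := by
  have hab : 0 < 2 * a * b := by positivity
  have habs : |a ^ 2 + b ^ 2 - d ^ 2| ≤ 2 * a * b := by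
    apply abs_le_of_sq_le_sq _ hab.le
    linarith [show (2 * a * b) ^ 2 = 4 * a ^ 2 * b ^ 2 by ring]
  rw [abs_le] at habs
  refine ⟨Real.cos_arccos ?_ ?_, ?_⟩
  · rw [le_div_iff₀ hab]; linarith
  · rw [div_le_one hab]; linarith
  · rw [Real.sin_arccos, eq_div_iff hab.ne']
    nth_rewrite 2 [← Real.sqrt_sq hab.le]
    rw [← Real.sqrt_mul' _ (sq_nonneg _)]
    congr 1
    field_simp
    ring

theorem dihedralAt_eq {ℓ : Fin 6 → ℝ} {i j k l : Fin 4} (hij : 0 < len ℓ i j)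
    (hik : 0 < len ℓ i k) (hil : 0 < len ℓ i l) (hk : 0 ≤ heron ℓ i j k)
    (hl : 0 ≤ heron ℓ i j l) (hkl : 0 ≤ heron ℓ i k l) :
    dihedralAt ℓ i j k l = Real.arccos (cosNumerAt ℓ i j k l /
      (Real.sqrt (heron ℓ i j k) * Real.sqrt (heron ℓ i j l))) := by
  have hjk := cos_sin_arccos_cosineLaw hij hik (d := len ℓ j k) hk
  have hjl := cos_sin_arccos_cosineLaw hij hil (d := len ℓ j l) hl
  have hkl := cos_sin_arccos_cosineLaw hik hil (d := len ℓ k l) hkl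
  rw [dihedralAt, faceAngle, faceAngle, faceAngle, hjk.1, hjk.2, hjl.1, hjl.2, hkl.1]
  change Real.arccos (_ / (Real.sqrt (heron ℓ i j k) / _ * (Real.sqrt (heron ℓ i j l) / _))) = _
  congr 1
  have hprod : (len ℓ i k ^ 2 + len ℓ i l ^ 2 - len ℓ k l ^ 2) / (2 * len ℓ i k * len ℓ i l) -
      (len ℓ i j ^ 2 + len ℓ i k ^ 2 - len ℓ j k ^ 2) / (2 * len ℓ i j * len ℓ i k) *
        ((len ℓ i j ^ 2 + len ℓ i l ^ 2 - len ℓ j l ^ 2) / (2 * len ℓ i j * len ℓ i l)) =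
      cosNumerAt ℓ i j k l / (2 * len ℓ i j * len ℓ i k * (2 * len ℓ i j * len ℓ i l)) := by
    rw [cosNumerAt]
    field_simp
  rw [hprod, div_mul_div_comm, div_div_div_cancel_right₀ (by positivity)]

theorem cayleyMenger_eq (ℓ : Fin 6 → ℝ) : cayleyMenger ℓ =
   2 * ℓ 0 ^ 2 * ℓ 5 ^ 2 * (ℓ 1 ^ 2 + ℓ 2 ^ 2 + ℓ 3 ^ 2 + ℓ 4 ^ 2 - ℓ 0 ^ 2 - ℓ 5 ^ 2)
   + 2 * ℓ 1 ^ 2 * ℓ 4 ^ 2 * (ℓ 0 ^ 2 + ℓ 2 ^ 2 + ℓ 3 ^ 2 + ℓ 5 ^ 2 - ℓ 1 ^ 2 - ℓ 4 ^ 2)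
   + 2 * ℓ 2 ^ 2 * ℓ 3 ^ 2 * (ℓ 0 ^ 2 + ℓ 1 ^ 2 + ℓ 4 ^ 2 + ℓ 5 ^ 2 - ℓ 2 ^ 2 - ℓ 3 ^ 2)
   - 2 * (ℓ 0 ^ 2 * ℓ 1 ^ 2 * ℓ 3 ^ 2 + ℓ 0 ^ 2 * ℓ 2 ^ 2 * ℓ 4 ^ 2
     + ℓ 1 ^ 2 * ℓ 2 ^ 2 * ℓ 5 ^ 2 + ℓ 3 ^ 2 * ℓ 4 ^ 2 * ℓ 5 ^ 2) := by
  rw [cayleyMenger, Matrix.det_succ_row_zero]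
  simp [Fin.sum_univ_succ, Matrix.det_succ_row_zero, Fin.succAbove, Matrix.submatrix]
  ring

/-- Geometrically Q_e = 16 A A' cos β_e, so this says that the area of a face is the sum of the
signed projections of the other three faces onto it. -/
theorem faceHeron_eq_sum (ℓ : Fin 6 → ℝ) :
    faceHeron 0 ℓ = cosNumer 3 ℓ + cosNumer 4 ℓ + cosNumer 5 ℓ ∧
    faceHeron 1 ℓ = cosNumer 1 ℓ + cosNumer 2 ℓ + cosNumer 5 ℓ ∧
    faceHeron 2 ℓ = cosNumer 0 ℓ + cosNumer 2 ℓ + cosNumer 4 ℓ ∧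
    faceHeron 3 ℓ = cosNumer 0 ℓ + cosNumer 1 ℓ + cosNumer 3 ℓ := by
  simp [faceHeron, cosNumer, cosNumerAt, heron, len, edgeEnds, edgeIndex, Fin.rev]
  refine ⟨?_, ?_, ?_, ?_⟩ <;> ring

/-- This is the volume formula V = 2 A A' sin β_e / (3 ℓ_e), squared, with V² = D / 288. The two
faces at e are those opposite to the endpoints of the opposite edge `e.rev`. -/
theorem faceHeron_mul_faceHeron_sub (ℓ : Fin 6 → ℝ) (e : Fin 6) :
    faceHeron (edgeEnds e.rev).1 ℓ * faceHeron (edgeEnds e.rev).2 ℓ - cosNumer e ℓ ^ 2 =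
      2 * ℓ e ^ 2 * cayleyMenger ℓ := by
  rw [cayleyMenger_eq]
  fin_cases e <;>
  · simp [faceHeron, cosNumer, cosNumerAt, heron, len, edgeEnds, edgeIndex, Fin.rev]
    ring

/-! ### The space of metrics as an open set of positivity conditions -/

/-- The edge lengths satisfying the positivity conditions that characterize nondegenerate
Euclidean tetrahedra. -/
structure IsNondegenerate (ℓ : Fin 6 → ℝ) : Prop where
  pos : ∀ e, 0 < ℓ e
  face : ∀ v, 0 < faceHeron v ℓ
  cm : 0 < cayleyMenger ℓ

/-- The dihedral angle at `e` in terms of the face areas. -/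
theorem dihedral_eq {ℓ : Fin 6 → ℝ} (h : IsNondegenerate ℓ) (e : Fin 6) :
    dihedral ℓ e = Real.arccos (cosNumer e ℓ /
      (Real.sqrt (faceHeron (edgeEnds e.rev).2 ℓ) *
        Real.sqrt (faceHeron (edgeEnds e.rev).1 ℓ))) := by
  have h0 := h.face 0
  have h1 := h.face 1
  have h2 := h.face 2
  have h3 := h.face 3
  have key : ∀ i j k l : Fin 4, heron ℓ i j k = faceHeron l ℓ → heron ℓ i j l = faceHeron k ℓ →
      heron ℓ i k l = faceHeron j ℓ → i ≠ j → i ≠ k → i ≠ l →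
      dihedralAt ℓ i j k l = Real.arccos (cosNumerAt ℓ i j k l /
        (Real.sqrt (faceHeron l ℓ) * Real.sqrt (faceHeron k ℓ))) := by
    intro i j k l hl hk hj hij hik hil
    rw [dihedralAt_eq _ _ _ (hl ▸ (h.face l).le) (hk ▸ (h.face k).le) (hj ▸ (h.face j).le), hl, hk]
    · rw [len, if_neg hij]; exact h.pos _
    · rw [len, if_neg hik]; exact h.pos _
    · rw [len, if_neg hil]; exact h.pos _
  rw [dihedral, cosNumer]
  apply key
  iterate 3
    fin_cases e <;>
    · simp [faceHeron, heron, len, edgeEnds, edgeIndex, Fin.rev]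
      try ring
  all_goals fin_cases e <;> simp [edgeEnds, Fin.rev]

theorem isNondegenerate_of_mem_met {ℓ : Fin 6 → ℝ} (h : ℓ ∈ met) : IsNondegenerate ℓ := by
  obtain ⟨p, hp, hd⟩ := h
  have hpos : ∀ e, 0 < ℓ e := by
    intro e
    rw [← hd e, dist_pos]
    refine hp.injective.ne ?_
    fin_cases e <;> simp [edgeEnds]
  have hlin := (affineIndependent_iff_linearIndependent_vsub ℝ p 0).1 hp
  have hlin3 : LinearIndependent ℝ fun i : Fin 3 => p i.succ - p 0 :=
    hlin.comp (fun i : Fin 3 => ⟨i.succ, Fin.succ_ne_zero i⟩) fun i j hij => by simpa using hij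
  have hdet := (Matrix.posDef_gram_of_linearIndependent hlin3).det_pos
  have hlen : ∀ i j, len ℓ i j = ‖p i - p j‖ := by
    have h0 := hd 0
    have h1 := hd 1
    have h2 := hd 2
    have h3 := hd 3
    have h4 := hd 4
    have h5 := hd 5
    simp only [edgeEnds, dist_eq_norm] at h0 h1 h2 h3 h4 h5
    intro i j
    fin_cases i <;> fin_cases j <;> simp [len, edgeIndex] <;>
      first
      | exact h0.symm | exact h1.symm | exact h2.symm | exact h3.symm | exact h4.symm
      | exact h5.symm | (rw [norm_sub_rev]; first
        | exact h0.symm | exact h1.symm | exact h2.symm | exact h3.symm | exact h4.symm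
        | exact h5.symm)
  have hinner : ∀ i j k, inner ℝ (p j - p i) (p k - p i) =
      (len ℓ i j ^ 2 + len ℓ i k ^ 2 - len ℓ j k ^ 2) / 2 := by
    intro i j k
    have := norm_sub_sq_real (p j - p i) (p k - p i)
    rw [sub_sub_sub_cancel_right] at this
    rw [hlen, hlen, hlen, norm_sub_rev (p i), norm_sub_rev (p i), this]
    ring
  have hheron : ∀ i j k, 0 ≤ heron ℓ i j k := by
    intro i j k
    have h1 := abs_real_inner_le_norm (p j - p i) (p k - p i)
    have h2 := pow_le_pow_left₀ (abs_nonneg _) h1 2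
    rw [sq_abs, hinner, mul_pow, norm_sub_rev, norm_sub_rev (p k), ← hlen, ← hlen] at h2
    rw [heron]
    linarith
  have hcm : 0 < cayleyMenger ℓ := by
    -- The Gram determinant of three edge vectors is 36 V² = D / 8; it is positive by affine
    -- independence.
    have h8 : (Matrix.gram ℝ fun i : Fin 3 => p i.succ - p 0).det = cayleyMenger ℓ / 8 := by
      rw [Matrix.det_fin_three, cayleyMenger_eq]
      simp only [Matrix.gram_apply, hinner]
      simp [len, edgeIndex]
      ring
    linarith
  have hface : ∀ v, 0 ≤ faceHeron v ℓ := by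
    intro v
    fin_cases v <;> exact hheron _ _ _
  refine ⟨hpos, fun v => (hface v).lt_of_ne' fun hv => ?_, hcm⟩
  -- No face degenerates, since H H' = Q_e² + 2 ℓ_e² D > 0.
  have key : ∀ e : Fin 6, 0 < faceHeron (edgeEnds e.rev).1 ℓ * faceHeron (edgeEnds e.rev).2 ℓ := by
    intro e
    have := faceHeron_mul_faceHeron_sub ℓ e
    have h2 : 0 < 2 * ℓ e ^ 2 * cayleyMenger ℓ :=
      mul_pos (mul_pos two_pos (pow_pos (hpos e) 2)) hcm
    nlinarith [sq_nonneg (cosNumer e ℓ)]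
  fin_cases v
  · simpa [edgeEnds, Fin.rev, show faceHeron 0 ℓ = 0 from hv] using key 5
  · simpa [edgeEnds, Fin.rev, show faceHeron 1 ℓ = 0 from hv] using key 5
  · simpa [edgeEnds, Fin.rev, show faceHeron 2 ℓ = 0 from hv] using key 0
  · simpa [edgeEnds, Fin.rev, show faceHeron 3 ℓ = 0 from hv] using key 0

theorem IsNondegenerate.mem_met {ℓ : Fin 6 → ℝ} (h : IsNondegenerate ℓ) : ℓ ∈ met := by
  have hpos := h.pos
  have ha := h.pos 0
  have hH : 0 < heron ℓ 0 1 2 := h.face 3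
  have hD := h.cm
  -- Explicit realization: the edge 01 lies on the first axis and the face 012 in the plane of the
  -- first two. Here s is 4 times the area of that face, so y = s / (2 ℓ_0) is its height over 01
  -- and z = √(D / 2) / s is the height 3V / A of the tetrahedron.
  set s := Real.sqrt (heron ℓ 0 1 2) with hs
  have hs0 : 0 < s := Real.sqrt_pos.2 hH
  have hs2 : s ^ 2 = heron ℓ 0 1 2 := Real.sq_sqrt hH.le
  set z := Real.sqrt (cayleyMenger ℓ / 2) / s with hz
  have hz0 : 0 < z := div_pos (Real.sqrt_pos.2 (by positivity)) hs0
  have hz2 : z ^ 2 * s ^ 2 = cayleyMenger ℓ / 2 := by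
    rw [hz, div_pow, Real.sq_sqrt (by positivity)]
    field_simp
  set y := s / (2 * ℓ 0) with hy
  have hy0 : 0 < y := by positivity
  set x := (ℓ 0 ^ 2 + ℓ 1 ^ 2 - ℓ 3 ^ 2) / (2 * ℓ 0) with hx
  set x' := (ℓ 0 ^ 2 + ℓ 2 ^ 2 - ℓ 4 ^ 2) / (2 * ℓ 0) with hx'
  set y' := cosNumer 0 ℓ / (2 * ℓ 0 * s) with hy'
  have e1 : x ^ 2 + y ^ 2 = ℓ 1 ^ 2 := by
    rw [hx, hy, div_pow, div_pow, hs2]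
    field_simp
    simp [heron, len, edgeIndex]
    ring
  have e2 : x' ^ 2 + y' ^ 2 + z ^ 2 = ℓ 2 ^ 2 := by
    have h1 := faceHeron_mul_faceHeron_sub ℓ 0
    have h2 : faceHeron (edgeEnds (Fin.rev 0)).2 ℓ = s ^ 2 := hs2.symm
    rw [h2] at h1
    have h3 : faceHeron (edgeEnds (Fin.rev 0)).1 ℓ =
      4 * ℓ 0 ^ 2 * ℓ 2 ^ 2 - (ℓ 0 ^ 2 + ℓ 2 ^ 2 - ℓ 4 ^ 2) ^ 2 := by
      simp [faceHeron, heron, len, edgeIndex, edgeEnds, Fin.rev]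
    rw [h3] at h1
    rw [hx', hy', div_pow, div_pow]
    have : z ^ 2 = cayleyMenger ℓ / 2 / s ^ 2 := by
      rw [eq_div_iff (by positivity), hz2]
    rw [this]
    field_simp
    linarith
  have e3 : x * x' + y * y' = (ℓ 1 ^ 2 + ℓ 2 ^ 2 - ℓ 5 ^ 2) / 2 := by
    have h1 : cosNumer 0 ℓ = 2 * ℓ 0 ^ 2 * (ℓ 1 ^ 2 + ℓ 2 ^ 2 - ℓ 5 ^ 2) -
        (ℓ 0 ^ 2 + ℓ 1 ^ 2 - ℓ 3 ^ 2) * (ℓ 0 ^ 2 + ℓ 2 ^ 2 - ℓ 4 ^ 2) := by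
      simp [cosNumer, cosNumerAt, edgeEnds, Fin.rev, len, edgeIndex]
    rw [hx, hx', hy, hy', h1]
    field_simp
    ring
  have e4 : 2 * ℓ 0 * x = ℓ 0 ^ 2 + ℓ 1 ^ 2 - ℓ 3 ^ 2 := by
    rw [hx]; field_simp
  have e5 : 2 * ℓ 0 * x' = ℓ 0 ^ 2 + ℓ 2 ^ 2 - ℓ 4 ^ 2 := by
    rw [hx']; field_simp
  refine ⟨![!₂[0, 0, 0], !₂[ℓ 0, 0, 0], !₂[x, y, 0], !₂[x', y', z]], ?_, ?_⟩
  · rw [affineIndependent_iff_of_fintype]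
    intro w hw hsum
    rw [Finset.weightedVSub_eq_linear_combination _ hw] at hsum
    have c0 := congrFun (congrArg WithLp.ofLp hsum) 0
    have c1 := congrFun (congrArg WithLp.ofLp hsum) 1
    have c2 := congrFun (congrArg WithLp.ofLp hsum) 2
    simp [Fin.sum_univ_four] at c0 c1 c2 hw
    have w3 : w 3 = 0 := c2.resolve_right hz0.ne'
    simp [w3, hy0.ne'] at c1
    simp [w3, c1, ha.ne'] at c0
    simp [w3, c1, c0] at hw
    intro i
    fin_cases i <;> assumption
  · intro e
    rw [EuclideanSpace.dist_eq, Real.sqrt_eq_iff_eq_sq (by positivity) (hpos e).le]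
    fin_cases e <;> simp [edgeEnds, Fin.sum_univ_three, Real.dist_eq, sq_abs] <;> linarith

theorem mem_met_iff {ℓ : Fin 6 → ℝ} : ℓ ∈ met ↔ IsNondegenerate ℓ :=
  ⟨isNondegenerate_of_mem_met, IsNondegenerate.mem_met⟩

theorem contDiff_cosNumer {n : WithTop ℕ∞} (e : Fin 6) : ContDiff ℝ n (cosNumer e) := by
  unfold cosNumer cosNumerAt len
  fin_cases e <;>
  · simp [edgeEnds, edgeIndex, Fin.rev]
    fun_prop

theorem contDiff_faceHeron {n : WithTop ℕ∞} (v : Fin 4) : ContDiff ℝ n (faceHeron v) := by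
  unfold faceHeron heron len
  fin_cases v <;>
  · simp [edgeIndex]
    fun_prop

theorem contDiff_cayleyMenger {n : WithTop ℕ∞} : ContDiff ℝ n cayleyMenger := by
  rw [funext cayleyMenger_eq]
  fun_prop

theorem isOpen_met : IsOpen met := by
  have : met = (⋂ e : Fin 6, {ℓ | 0 < ℓ e}) ∩ (⋂ v : Fin 4, {ℓ | 0 < faceHeron v ℓ}) ∩
      {ℓ | 0 < cayleyMenger ℓ} := by
    ext ℓ
    rw [mem_met_iff]
    simp only [Set.mem_inter_iff, Set.mem_iInter, Set.mem_ofPred_eq]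
    exact ⟨fun h => ⟨⟨h.pos, h.face⟩, h.cm⟩, fun h => ⟨h.1.1, h.1.2, h.2⟩⟩
  rw [this]
  refine ((isOpen_iInter_of_finite fun e => ?_).inter (isOpen_iInter_of_finite fun v => ?_)).inter ?_
  · exact isOpen_lt continuous_const (continuous_apply e)
  · exact isOpen_lt continuous_const (contDiff_faceHeron (n := 0) v).continuous
  · exact isOpen_lt continuous_const (contDiff_cayleyMenger (n := 0)).continuous

/-! ### Differentials of the dihedral angles and the Schläfli formula -/

/-- The sine of the angle is s / √(h₁ h₂), so the radicals produced by the derivative of arccos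
cancel, and only s and logarithmic derivatives of h₁, h₂ remain. -/
theorem hasFDerivAt_arccos_div_sqrt {E : Type*} [NormedAddCommGroup E] [NormedSpace ℝ E]
    {q h₁ h₂ : E → ℝ} {q' h₁' h₂' : E →L[ℝ] ℝ} {x : E} {s : ℝ} (hq : HasFDerivAt q q' x)
    (hh₁ : HasFDerivAt h₁ h₁' x) (hh₂ : HasFDerivAt h₂ h₂' x) (p₁ : 0 < h₁ x) (p₂ : 0 < h₂ x)
    (hs : 0 < s) (hs2 : h₁ x * h₂ x - q x ^ 2 = s ^ 2) :
    HasFDerivAt (fun y => Real.arccos (q y / (Real.sqrt (h₁ y) * Real.sqrt (h₂ y))))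
      (-s⁻¹ • (q' - (q x / (2 * h₁ x)) • h₁' - (q x / (2 * h₂ x)) • h₂')) x := by
  set r₁ := Real.sqrt (h₁ x) with hr₁
  set r₂ := Real.sqrt (h₂ x) with hr₂
  have r₁0 : 0 < r₁ := Real.sqrt_pos.2 p₁
  have r₂0 : 0 < r₂ := Real.sqrt_pos.2 p₂
  have r₁2 : h₁ x = r₁ ^ 2 := (Real.sq_sqrt p₁.le).symm
  have r₂2 : h₂ x = r₂ ^ 2 := (Real.sq_sqrt p₂.le).symm
  have hc : 1 - (q x / (r₁ * r₂)) ^ 2 = (s / (r₁ * r₂)) ^ 2 := by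
    rw [r₁2, r₂2] at hs2
    field_simp
    linarith
  have hc0 : 0 < (s / (r₁ * r₂)) ^ 2 := by positivity
  have hd := (hh₁.sqrt p₁.ne').mul (hh₂.sqrt p₂.ne')
  have hd2 := hq.mul ((hasDerivAt_inv (mul_pos r₁0 r₂0).ne').comp_hasFDerivAt x hd)
  have hne1 : q x / (r₁ * r₂) ≠ -1 := by
    intro h
    rw [h] at hc
    linarith
  have hne2 : q x / (r₁ * r₂) ≠ 1 := by
    intro h
    rw [h] at hc
    linarith
  have hd3 := (Real.hasDerivAt_arccos hne1 hne2).comp_hasFDerivAt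
    (f := fun y => q y / (Real.sqrt (h₁ y) * Real.sqrt (h₂ y))) x hd2
  refine hd3.congr_fderiv ?_
  rw [hc, Real.sqrt_sq (by positivity)]
  ext v
  simp only [smul_apply, add_apply, sub_apply, smul_eq_mul, Pi.mul_apply, ← hr₁, ← hr₂,
    Function.comp]
  rw [r₁2, r₂2]
  field_simp
  ring

theorem IsNondegenerate.sqrt_pos {ℓ : Fin 6 → ℝ} (h : IsNondegenerate ℓ) :
    0 < Real.sqrt (2 * cayleyMenger ℓ) :=
  Real.sqrt_pos.2 (mul_pos two_pos h.cm)

theorem eventually_isNondegenerate {ℓ : Fin 6 → ℝ} (h : IsNondegenerate ℓ) :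
    ∀ᶠ m in 𝓝 ℓ, IsNondegenerate m := by
  filter_upwards [isOpen_met.mem_nhds (mem_met_iff.2 h)] with m hm using mem_met_iff.1 hm

theorem hasFDerivAt_cosNumer (e : Fin 6) (ℓ : Fin 6 → ℝ) :
    HasFDerivAt (cosNumer e) (fderiv ℝ (cosNumer e) ℓ) ℓ :=
  ((contDiff_cosNumer (n := 1) e).differentiable (by simp) ℓ).hasFDerivAt

theorem hasFDerivAt_faceHeron (v : Fin 4) (ℓ : Fin 6 → ℝ) :
    HasFDerivAt (faceHeron v) (fderiv ℝ (faceHeron v) ℓ) ℓ :=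
  ((contDiff_faceHeron (n := 1) v).differentiable (by simp) ℓ).hasFDerivAt

/-- The differential of the dihedral angle at `e`. -/
theorem hasFDerivAt_dihedral {ℓ : Fin 6 → ℝ} (h : IsNondegenerate ℓ) (e : Fin 6) :
    HasFDerivAt (fun m => dihedral m e)
      (-(ℓ e * Real.sqrt (2 * cayleyMenger ℓ))⁻¹ •
        (fderiv ℝ (cosNumer e) ℓ -
          (cosNumer e ℓ / (2 * faceHeron (edgeEnds e.rev).2 ℓ)) •
            fderiv ℝ (faceHeron (edgeEnds e.rev).2) ℓ -
          (cosNumer e ℓ / (2 * faceHeron (edgeEnds e.rev).1 ℓ)) •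
            fderiv ℝ (faceHeron (edgeEnds e.rev).1) ℓ)) ℓ := by
  refine (hasFDerivAt_arccos_div_sqrt (hasFDerivAt_cosNumer e ℓ) (hasFDerivAt_faceHeron _ ℓ)
    (hasFDerivAt_faceHeron _ ℓ) (h.face _) (h.face _) (mul_pos (h.pos e) h.sqrt_pos)
    ?_).congr_of_eventuallyEq ?_
  · rw [mul_pow, Real.sq_sqrt (mul_pos two_pos h.cm).le,
      mul_comm (faceHeron _ _), faceHeron_mul_faceHeron_sub]
    ring
  · filter_upwards [eventually_isNondegenerate h] with m hm using dihedral_eq hm e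

theorem fderiv_faceHeron (ℓ : Fin 6 → ℝ) :
    fderiv ℝ (faceHeron 0) ℓ =
      fderiv ℝ (cosNumer 3) ℓ + fderiv ℝ (cosNumer 4) ℓ + fderiv ℝ (cosNumer 5) ℓ ∧
    fderiv ℝ (faceHeron 1) ℓ =
      fderiv ℝ (cosNumer 1) ℓ + fderiv ℝ (cosNumer 2) ℓ + fderiv ℝ (cosNumer 5) ℓ ∧
    fderiv ℝ (faceHeron 2) ℓ =
      fderiv ℝ (cosNumer 0) ℓ + fderiv ℝ (cosNumer 2) ℓ + fderiv ℝ (cosNumer 4) ℓ ∧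
    fderiv ℝ (faceHeron 3) ℓ =
      fderiv ℝ (cosNumer 0) ℓ + fderiv ℝ (cosNumer 1) ℓ + fderiv ℝ (cosNumer 3) ℓ := by
  have key : ∀ a b c e, (∀ m, faceHeron e m = cosNumer a m + cosNumer b m + cosNumer c m) →
      fderiv ℝ (faceHeron e) ℓ =
        fderiv ℝ (cosNumer a) ℓ + fderiv ℝ (cosNumer b) ℓ + fderiv ℝ (cosNumer c) ℓ := by
    intro a b c e h
    rw [funext h]
    exact (((hasFDerivAt_cosNumer a ℓ).add (hasFDerivAt_cosNumer b ℓ)).add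
      (hasFDerivAt_cosNumer c ℓ)).fderiv
  exact ⟨key _ _ _ _ fun m => (faceHeron_eq_sum m).1,
    key _ _ _ _ fun m => (faceHeron_eq_sum m).2.1,
    key _ _ _ _ fun m => (faceHeron_eq_sum m).2.2.1,
    key _ _ _ _ fun m => (faceHeron_eq_sum m).2.2.2⟩

/-- The **Schläfli formula**: `∑ ℓ_e dβ_e = 0`. -/
theorem sum_smul_fderiv_dihedral {ℓ : Fin 6 → ℝ} (h : IsNondegenerate ℓ) :
    ∑ e, ℓ e • fderiv ℝ (fun m => dihedral m e) ℓ = 0 := by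
  have hs := h.sqrt_pos
  -- The weight ℓ_e cancels the factor 1 / ℓ_e in dβ_e, leaving a prefactor common to all edges.
  have hterm : ∀ e, ℓ e • fderiv ℝ (fun m => dihedral m e) ℓ =
      -(Real.sqrt (2 * cayleyMenger ℓ))⁻¹ •
        (fderiv ℝ (cosNumer e) ℓ -
          cosNumer e ℓ • ((2 * faceHeron (edgeEnds e.rev).2 ℓ)⁻¹ •
            fderiv ℝ (faceHeron (edgeEnds e.rev).2) ℓ) -
          cosNumer e ℓ • ((2 * faceHeron (edgeEnds e.rev).1 ℓ)⁻¹ •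
            fderiv ℝ (faceHeron (edgeEnds e.rev).1) ℓ)) := by
    intro e
    have he := h.pos e
    rw [(hasFDerivAt_dihedral h e).fderiv, smul_smul, smul_smul, smul_smul, div_eq_mul_inv,
      div_eq_mul_inv]
    congr 1
    field_simp
  rw [Finset.sum_congr rfl fun e _ => hterm e, ← Finset.smul_sum]
  obtain ⟨f0, f1, f2, f3⟩ := fderiv_faceHeron ℓ
  obtain ⟨g0, g1, g2, g3⟩ := faceHeron_eq_sum ℓ
  rw [smul_eq_zero]
  right
  ext v
  -- Regrouped by faces, the coefficients Q_e add up to H_v and cancel its inverse, leaving ∑ dQ_e -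
  -- ½ ∑ dH_v. This vanishes because every edge lies in two faces.
  have hr : ∀ i, faceHeron i ℓ * ((faceHeron i ℓ)⁻¹ * 2⁻¹ * fderiv ℝ (faceHeron i) ℓ v) =
      fderiv ℝ (faceHeron i) ℓ v / 2 := fun i => by
    have := h.face i
    field_simp
  have h0 := hr 0
  have h1 := hr 1
  have h2 := hr 2
  have h3 := hr 3
  nth_rewrite 1 [g0] at h0
  nth_rewrite 1 [g1] at h1
  nth_rewrite 1 [g2] at h2
  nth_rewrite 1 [g3] at h3
  have k0 := congrArg (fun L => L v) f0
  have k1 := congrArg (fun L => L v) f1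
  have k2 := congrArg (fun L => L v) f2
  have k3 := congrArg (fun L => L v) f3
  simp only [add_apply] at k0 k1 k2 k3
  simp [Fin.sum_univ_six, edgeEnds, Fin.rev]
  linear_combination -(h0 + h1 + h2 + h3) - (k0 + k1 + k2 + k3) / 2

/-- By the Schläfli formula the variation of the angles contributes nothing. -/
theorem hasFDerivAt_EHR {ℓ : Fin 6 → ℝ} (h : IsNondegenerate ℓ) :
    HasFDerivAt EHR (∑ e, (2 * Real.pi - 2 * dihedral ℓ e) •
      (ContinuousLinearMap.proj e : (Fin 6 → ℝ) →L[ℝ] ℝ)) ℓ := by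
  have hE : EHR = fun m => ∑ e, (2 * Real.pi - 2 * dihedral m e) * m e := by
    funext m
    simp [EHR, edgeCurvature, two_mul]
  have hd : ∀ e ∈ Finset.univ, HasFDerivAt (fun m => (2 * Real.pi - 2 * dihedral m e) * m e) _ ℓ :=
    fun e _ => ((((hasFDerivAt_dihedral h e).differentiableAt.hasFDerivAt).const_mul 2).const_sub
      (2 * Real.pi)).mul (ContinuousLinearMap.proj (R := ℝ) (φ := fun _ : Fin 6 => ℝ) e).hasFDerivAt
  rw [hE]
  refine (HasFDerivAt.fun_sum hd).congr_fderiv ?_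
  have hS := sum_smul_fderiv_dihedral h
  have h2 : ∑ e, ℓ e • -((2:ℝ) • fderiv ℝ (fun m => dihedral m e) ℓ) = 0 := by
    have h3 := congrArg (fun L => (-2 : ℝ) • L) hS
    simp only [smul_zero, Finset.smul_sum] at h3
    rw [← h3]
    refine Finset.sum_congr rfl fun e _ => ?_
    module
  rw [Finset.sum_add_distrib]
  refine (add_eq_left.2 h2)

/-! ### Rigidity: equal dihedral angles force equal lengths -/

theorem cos_dihedral {ℓ : Fin 6 → ℝ} (h : IsNondegenerate ℓ) (e : Fin 6) :
    cosNumer e ℓ = Real.cos (dihedral ℓ e) *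
      (Real.sqrt (faceHeron (edgeEnds e.rev).2 ℓ) *
        Real.sqrt (faceHeron (edgeEnds e.rev).1 ℓ)) := by
  have h1 := Real.sqrt_pos.2 (h.face (edgeEnds e.rev).1)
  have h2 := Real.sqrt_pos.2 (h.face (edgeEnds e.rev).2)
  have h12 := mul_pos h2 h1
  have habs : |cosNumer e ℓ| ≤ Real.sqrt (faceHeron (edgeEnds e.rev).2 ℓ) *
        Real.sqrt (faceHeron (edgeEnds e.rev).1 ℓ) := by
    apply abs_le_of_sq_le_sq _ h12.le
    rw [mul_pow, Real.sq_sqrt (h.face _).le, Real.sq_sqrt (h.face _).le]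
    have := faceHeron_mul_faceHeron_sub ℓ e
    have h2 : 0 < 2 * ℓ e ^ 2 * cayleyMenger ℓ :=
      mul_pos (mul_pos two_pos (pow_pos (h.pos e) 2)) h.cm
    linarith
  rw [abs_le] at habs
  rw [dihedral_eq h, Real.cos_arccos, div_mul_cancel₀ _ h12.ne']
  · rw [le_div_iff₀ h12]; linarith
  · rw [div_le_one h12]; linarith

/-- A tetrahedron all of whose dihedral angles agree is regular. -/
theorem eq_equalLength_of_dihedral_eq {ℓ : Fin 6 → ℝ} (h : IsNondegenerate ℓ) {β : ℝ}
    (hβ : ∀ e, dihedral ℓ e = β) : ∃ k : ℝ, 0 < k ∧ ℓ = equalLength k := by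
  have hQ := fun e => cos_dihedral h e
  have hJ := fun e => faceHeron_mul_faceHeron_sub ℓ e
  obtain ⟨g0, g1, g2, g3⟩ := faceHeron_eq_sum ℓ
  have hs : ∀ v, faceHeron v ℓ = Real.sqrt (faceHeron v ℓ) ^ 2 :=
    fun v => (Real.sq_sqrt (h.face v).le).symm
  have hp : ∀ v, 0 < Real.sqrt (faceHeron v ℓ) := fun v => Real.sqrt_pos.2 (h.face v)
  simp only [hβ] at hQ
  generalize Real.cos β = x at hQ
  have q0 := hQ 0
  have q1 := hQ 1
  have q2 := hQ 2
  have q3 := hQ 3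
  have q4 := hQ 4
  have q5 := hQ 5
  simp only [edgeEnds, Fin.rev] at q0 q1 q2 q3 q4 q5
  simp at q0 q1 q2 q3 q4 q5
  obtain ⟨s, hsdef⟩ : ∃ s : Fin 4 → ℝ, ∀ v, Real.sqrt (faceHeron v ℓ) = s v := ⟨_, fun _ => rfl⟩
  simp only [hsdef] at hs hp q0 q1 q2 q3 q4 q5 hQ
  rw [hs, q3, q4, q5] at g0
  rw [hs, q1, q2, q5] at g1
  rw [hs, q0, q2, q4] at g2
  rw [hs, q0, q1, q3] at g3
  have p0 := hp 0
  have p1 := hp 1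
  have p2 := hp 2
  have p3 := hp 3
  -- The projection identity divided by s_v, where s_v is proportional to the area of face v and x =
  -- cos β. Subtracting two such equations gives (1 + x)(s_v - s_w) = 0.
  replace g0 : s 0 = x * (s 1 + s 2 + s 3) := by
    apply mul_left_cancel₀ p0.ne'; linarith
  replace g1 : s 1 = x * (s 0 + s 2 + s 3) := by
    apply mul_left_cancel₀ p1.ne'; linarith
  replace g2 : s 2 = x * (s 0 + s 1 + s 3) := by
    apply mul_left_cancel₀ p2.ne'; linarith
  replace g3 : s 3 = x * (s 0 + s 1 + s 2) := by
    apply mul_left_cancel₀ p3.ne'; linarith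
  -- If x ≤ -1, the right sides would be negative while every s_v is positive.
  have hx : 0 < 1 + x := by
    by_contra hx
    nlinarith
  have hall : ∀ v, s v = s 0 := by
    have e1 : s 1 = s 0 := by
      apply mul_left_cancel₀ hx.ne'; linarith
    have e2 : s 2 = s 0 := by
      apply mul_left_cancel₀ hx.ne'; linarith
    have e3 : s 3 = s 0 := by
      apply mul_left_cancel₀ hx.ne'; linarith
    intro v
    fin_cases v <;> first | rfl | assumption
  refine ⟨ℓ 0, h.pos 0, funext fun e => ?_⟩
  have hD := h.cm
  -- With all face areas and all cosines equal, H H' - Q_e² no longer depends on e, hence neither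
  -- does ℓ_e².
  have j : ∀ e, 2 * ℓ e ^ 2 * cayleyMenger ℓ = s 0 ^ 4 * (1 - x ^ 2) := by
    intro e
    rw [← hJ e, hQ e, hs, hs (edgeEnds e.rev).2]
    simp only [hall]
    ring
  have := (j e).trans (j 0).symm
  have h2 : ℓ e ^ 2 = ℓ 0 ^ 2 := by
    apply mul_left_cancel₀ (mul_pos two_pos hD).ne'; linarith
  exact (pow_left_inj₀ (h.pos e).le (h.pos 0).le two_ne_zero).1 h2

/-! ### Values at the equal length metrics -/

theorem faceHeron_equalLength (k : ℝ) (v : Fin 4) : faceHeron v (equalLength k) = 3 * k ^ 4 := by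
  fin_cases v <;>
  · simp [faceHeron, heron, len, equalLength]
    ring

theorem cosNumer_equalLength (k : ℝ) (e : Fin 6) : cosNumer e (equalLength k) = k ^ 4 := by
  fin_cases e <;>
  · simp [cosNumer, cosNumerAt, len, equalLength, edgeEnds, Fin.rev]
    ring

theorem cayleyMenger_equalLength (k : ℝ) : cayleyMenger (equalLength k) = 4 * k ^ 6 := by
  rw [cayleyMenger_eq]
  simp only [equalLength]
  ring

theorem isNondegenerate_equalLength {k : ℝ} (hk : 0 < k) : IsNondegenerate (equalLength k) := by
  refine ⟨fun e => hk, fun v => ?_, ?_⟩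
  · rw [faceHeron_equalLength]; positivity
  · rw [cayleyMenger_equalLength]; positivity

theorem dihedral_equalLength {k : ℝ} (hk : 0 < k) (e : Fin 6) :
    dihedral (equalLength k) e = Real.arccos (1 / 3) := by
  rw [dihedral_eq (isNondegenerate_equalLength hk), cosNumer_equalLength, faceHeron_equalLength,
    faceHeron_equalLength, Real.mul_self_sqrt (by positivity)]
  congr 1
  field_simp

theorem edgeCurvature_eq (ℓ : Fin 6 → ℝ) (e : Fin 6) :
    edgeCurvature ℓ e = (2 * Real.pi - 2 * dihedral ℓ e) * ℓ e := by
  simp [edgeCurvature, two_mul]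

theorem isLEinstein_equalLength {k : ℝ} (hk : 0 < k) : IsLEinstein (equalLength k) :=
  ⟨mem_met_iff.2 (isNondegenerate_equalLength hk), 2 * Real.pi - 2 * Real.arccos (1 / 3), fun e => by
    rw [edgeCurvature_eq, dihedral_equalLength hk]⟩

theorem isLEinstein_iff (ℓ : Fin 6 → ℝ) :
    IsLEinstein ℓ ↔ ∃ k : ℝ, 0 < k ∧ ℓ = equalLength k := by
  refine ⟨fun ⟨hm, c, hc⟩ => ?_, fun ⟨k, hk, h⟩ => h ▸ isLEinstein_equalLength hk⟩
  have h := mem_met_iff.1 hm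
  refine eq_equalLength_of_dihedral_eq h (β := (2 * Real.pi - c) / 2) fun e => ?_
  have := hc e
  rw [edgeCurvature_eq] at this
  linarith [mul_right_cancel₀ (h.pos e).ne' this]

/-! ### First derivatives at the equal length metrics -/

/-- The covector `∑ g_e dℓ_e`. -/
def covector (g : Fin 6 → ℝ) : (Fin 6 → ℝ) →L[ℝ] ℝ :=
  ∑ e, g e • ContinuousLinearMap.proj e

@[simp]
theorem covector_apply (g v : Fin 6 → ℝ) : covector g v = ∑ e, g e * v e := by
  simp [covector]

/-- The linear form `p ∑ v_i + q v_e + r v_{e'}` for opposite edges `e`, `e'`. -/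
def edgeForm (p q r : ℝ) (e : Fin 6) : (Fin 6 → ℝ) →L[ℝ] ℝ :=
  p • covector 1 + q • ContinuousLinearMap.proj e + r • ContinuousLinearMap.proj e.rev

@[simp]
theorem edgeForm_apply (p q r : ℝ) (e : Fin 6) (v : Fin 6 → ℝ) :
    edgeForm p q r e v = p * ∑ i, v i + q * v e + r * v e.rev := by
  simp [edgeForm]

theorem hasFDerivAt_apply_sq (e : Fin 6) (ℓ : Fin 6 → ℝ) :
    HasFDerivAt (fun m : Fin 6 → ℝ => m e ^ 2)
      ((2 * ℓ e) • (ContinuousLinearMap.proj e : (Fin 6 → ℝ) →L[ℝ] ℝ)) ℓ := by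
  have := (ContinuousLinearMap.proj (R := ℝ) (φ := fun _ : Fin 6 => ℝ) e).hasFDerivAt (x := ℓ)
  simpa using! this.pow 2

theorem hasFDerivAt_cosNumer_equalLength (k : ℝ) (e : Fin 6) :
    HasFDerivAt (cosNumer e) (edgeForm (2 * k ^ 3) (-2 * k ^ 3) (-6 * k ^ 3) e)
      (equalLength k) := by
  have key : ∀ a b c d f g : Fin 6, HasFDerivAt (fun ℓ : Fin 6 → ℝ =>
      2 * ℓ a ^ 2 * (ℓ b ^ 2 + ℓ c ^ 2 - ℓ g ^ 2) -
        (ℓ a ^ 2 + ℓ b ^ 2 - ℓ d ^ 2) * (ℓ a ^ 2 + ℓ c ^ 2 - ℓ f ^ 2))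
      ((2 * k ^ 3) • ((ContinuousLinearMap.proj b : (Fin 6 → ℝ) →L[ℝ] ℝ) + ContinuousLinearMap.proj c +
        ContinuousLinearMap.proj d + ContinuousLinearMap.proj f -
        (2 : ℝ) • ContinuousLinearMap.proj g)) (equalLength k) := by
    intro a b c d f g
    have h := fun i => hasFDerivAt_apply_sq i (equalLength k)
    refine ((((h a).const_mul 2).fun_mul (((h b).fun_add (h c)).fun_sub (h g))).fun_sub
      ((((h a).fun_add (h b)).fun_sub (h d)).fun_mul
        (((h a).fun_add (h c)).fun_sub (h f)))).congr_fderiv ?_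
    ext v
    simp [equalLength]
    ring
  -- Here a is the edge e, g is the opposite edge, and b, c, d, f are the four edges adjacent to e.
  have h : ∀ a b c d f g : Fin 6, (cosNumer e = fun ℓ : Fin 6 → ℝ =>
      2 * ℓ a ^ 2 * (ℓ b ^ 2 + ℓ c ^ 2 - ℓ g ^ 2) -
        (ℓ a ^ 2 + ℓ b ^ 2 - ℓ d ^ 2) * (ℓ a ^ 2 + ℓ c ^ 2 - ℓ f ^ 2)) →
      (∀ v : Fin 6 → ℝ, v b + v c + v d + v f - 2 * v g = ∑ i, v i - v e - 3 * v e.rev) →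
      HasFDerivAt (cosNumer e) (edgeForm (2 * k ^ 3) (-2 * k ^ 3) (-6 * k ^ 3) e)
        (equalLength k) := by
    intro a b c d f g hf hv
    rw [hf]
    refine (key a b c d f g).congr_fderiv ?_
    ext v
    have := hv v
    simp only [smul_apply, add_apply, sub_apply, smul_eq_mul, edgeForm_apply,
      ContinuousLinearMap.proj_apply]
    rw [this]
    ring
  fin_cases e
  · refine h 0 1 2 3 4 5 ?_ ?_
    · ext ℓ; simp [cosNumer, cosNumerAt, len, edgeIndex, edgeEnds, Fin.rev]
    · intro v; simp [Fin.sum_univ_six, Fin.rev]; ring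
  · refine h 1 0 2 3 5 4 ?_ ?_
    · ext ℓ; simp [cosNumer, cosNumerAt, len, edgeIndex, edgeEnds, Fin.rev]
    · intro v; simp [Fin.sum_univ_six, Fin.rev]; ring
  · refine h 2 0 1 4 5 3 ?_ ?_
    · ext ℓ; simp [cosNumer, cosNumerAt, len, edgeIndex, edgeEnds, Fin.rev]
    · intro v; simp [Fin.sum_univ_six, Fin.rev]; ring
  · refine h 3 0 4 1 5 2 ?_ ?_
    · ext ℓ; simp [cosNumer, cosNumerAt, len, edgeIndex, edgeEnds, Fin.rev]
    · intro v; simp [Fin.sum_univ_six, Fin.rev]; ring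
  · refine h 4 0 3 2 5 1 ?_ ?_
    · ext ℓ; simp [cosNumer, cosNumerAt, len, edgeIndex, edgeEnds, Fin.rev]
    · intro v; simp [Fin.sum_univ_six, Fin.rev]; ring
  · refine h 5 1 3 2 4 0 ?_ ?_
    · ext ℓ; simp [cosNumer, cosNumerAt, len, edgeIndex, edgeEnds, Fin.rev]
    · intro v; simp [Fin.sum_univ_six, Fin.rev]; ring

/-- The coefficients satisfy 6p + q + r = 0, as they must since angles do not change under scaling.
-/
theorem hasFDerivAt_dihedral_equalLength {k : ℝ} (hk : 0 < k) (e : Fin 6) :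
    HasFDerivAt (fun ℓ => dihedral ℓ e)
      (edgeForm (-Real.sqrt 2 / (3 * k)) (2 * Real.sqrt 2 / (3 * k)) (4 * Real.sqrt 2 / (3 * k)) e)
      (equalLength k) := by
  refine (hasFDerivAt_dihedral (isNondegenerate_equalLength hk) e).congr_fderiv ?_
  have hs : Real.sqrt (2 * cayleyMenger (equalLength k)) = 2 * Real.sqrt 2 * k ^ 3 := by
    rw [cayleyMenger_equalLength, Real.sqrt_eq_iff_eq_sq (by positivity) (by positivity),
      mul_pow, mul_pow, Real.sq_sqrt (by norm_num)]
    ring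
  have hr : Real.sqrt 2 * Real.sqrt 2 = 2 := Real.mul_self_sqrt (by norm_num)
  have hr0 : 0 < Real.sqrt 2 := by positivity
  obtain ⟨f0, f1, f2, f3⟩ := fderiv_faceHeron (equalLength k)
  have hq := fun i => (hasFDerivAt_cosNumer_equalLength k i).fderiv
  have hinv : (k * (2 * Real.sqrt 2 * k ^ 3))⁻¹ = Real.sqrt 2 / (4 * k ^ 4) := by
    field_simp
    linarith
  have hh : k ^ 4 / (2 * (3 * k ^ 4)) = 1 / 6 := by
    field_simp
    norm_num
  rw [hs, show equalLength k e = k from rfl, hinv]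
  simp only [cosNumer_equalLength, faceHeron_equalLength, hh]
  ext v
  fin_cases e <;>
  · simp [edgeEnds, Fin.rev, f0, f1, f2, f3, hq, Fin.sum_univ_six]
    field_simp
    ring

/-- The angle at the opposite edge governs the change of volume: ∂V/∂ℓ_e = ℓ_e ℓ_e' cot β_e' / 6,
with e' opposite to e. -/
theorem hasFDerivAt_cayleyMenger (ℓ : Fin 6 → ℝ) :
    HasFDerivAt cayleyMenger (covector fun e => 4 * ℓ e * cosNumer e.rev ℓ) ℓ := by
  have h := fun i => hasFDerivAt_apply_sq i ℓ
  have key : ∀ a b c d f g : Fin 6, HasFDerivAt (fun ℓ : Fin 6 → ℝ =>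
      2 * ℓ a ^ 2 * ℓ b ^ 2 * (ℓ c ^ 2 + ℓ d ^ 2 + ℓ f ^ 2 + ℓ g ^ 2 - ℓ a ^ 2 - ℓ b ^ 2)) _ ℓ :=
    fun a b c d f g => ((((h a).const_mul 2).fun_mul (h b)).fun_mul
      ((((((h c).fun_add (h d)).fun_add (h f)).fun_add (h g)).fun_sub (h a)).fun_sub (h b)))
  have key2 : ∀ a b c : Fin 6, HasFDerivAt (fun ℓ : Fin 6 → ℝ => ℓ a ^ 2 * ℓ b ^ 2 * ℓ c ^ 2) _ ℓ :=
    fun a b c => ((h a).fun_mul (h b)).fun_mul (h c)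
  rw [funext cayleyMenger_eq]
  refine ((((key 0 5 1 2 3 4).fun_add (key 1 4 0 2 3 5)).fun_add (key 2 3 0 1 4 5)).fun_sub
    (((((key2 0 1 3).fun_add (key2 0 2 4)).fun_add (key2 1 2 5)).fun_add
      (key2 3 4 5)).const_mul 2)).congr_fderiv ?_
  ext v
  simp [Fin.sum_univ_six, cosNumer, cosNumerAt, len, edgeIndex, edgeEnds, Fin.rev]
  ring

/-! ### Second order expansions and Hessian eigenspaces -/

/-- Second order Taylor expansion at a critical point, with the Peano remainder. -/
theorem isLittleO_sub_half_second_derivative {E : Type*} [NormedAddCommGroup E] [NormedSpace ℝ E]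
    {F : E → ℝ} {F' : E → E →L[ℝ] ℝ} {B : E →L[ℝ] E →L[ℝ] ℝ} {x : E}
    (hF : ∀ᶠ y in 𝓝 x, HasFDerivAt F (F' y) y) (h0 : F' x = 0) (hB : HasFDerivAt F' B x) :
    (fun y => F y - F x - (1 / 2) * B (y - x) (y - x)) =o[𝓝 x] fun y => ‖y - x‖ ^ 2 := by
  have hsymm : ∀ v w, B v w = B w v := second_derivative_symmetric_of_eventually hF hB
  obtain ⟨r, hr, hball⟩ := Metric.eventually_nhds_iff_ball.1 hF
  have hnhds : 𝓝[Metric.ball x r] x = 𝓝 x := (Metric.isOpen_ball).nhdsWithin_eq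
    (Metric.mem_ball_self hr)
  -- The remainder has derivative F' y - B (y - x), by symmetry of B, and this is o(‖y - x‖);
  -- integrating along segments in the ball gains one order.
  have key := (convex_ball x r).isLittleO_pow_succ (n := 1)
    (f := fun y => F y - F x - (1 / 2) * B (y - x) (y - x))
    (f' := fun y => F' y - B (y - x)) (Metric.mem_ball_self hr) ?_ ?_
  · simpa [hnhds] using key
  · intro y hy
    have h1 := hball y hy
    have hid : HasFDerivAt (fun y => y - x) (ContinuousLinearMap.id ℝ E) y :=
      (hasFDerivAt_id y).sub_const x
    have h2 := (B.hasFDerivAt.comp y hid).clm_apply hid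
    refine ((h1.sub_const (F x)).sub (h2.const_mul (1 / 2))).hasFDerivWithinAt.congr_fderiv ?_
    ext v
    simp [hsymm v]
    ring
  · rw [hnhds]
    have := hB.isLittleO
    simpa [h0] using this

theorem hasFDerivAt_covector {g : Fin 6 → (Fin 6 → ℝ) → ℝ} {g' : Fin 6 → (Fin 6 → ℝ) →L[ℝ] ℝ}
    {ℓ : Fin 6 → ℝ} (hg : ∀ e, HasFDerivAt (g e) (g' e) ℓ) :
    HasFDerivAt (fun m => covector fun e => g e m)
      (∑ e, (g' e).smulRight (ContinuousLinearMap.proj e : (Fin 6 → ℝ) →L[ℝ] ℝ)) ℓ := by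
  unfold covector
  exact HasFDerivAt.fun_sum fun e _ =>
    (hg e).smul_const (ContinuousLinearMap.proj e : (Fin 6 → ℝ) →L[ℝ] ℝ)

theorem sum_smulRight_apply (p q r : ℝ) (v w : Fin 6 → ℝ) :
    (∑ e, (edgeForm p q r e).smulRight (ContinuousLinearMap.proj e : (Fin 6 → ℝ) →L[ℝ] ℝ)) v w =
      p * (∑ e, v e) * (∑ e, w e) + q * ∑ e, v e * w e + r * ∑ e, v e.rev * w e := by
  simp [Fin.sum_univ_six]
  ring

/-- The second order data of a functional at an equal length metric: near `ℓ` its differential is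
`∑ g_e dℓ_e`, where `g` vanishes at `ℓ` with differential `edgeForm p q r`. -/
structure HasSecondOrder (F : (Fin 6 → ℝ) → ℝ) (ℓ : Fin 6 → ℝ) (p q r : ℝ) : Prop where
  exists_gradient : ∃ g : Fin 6 → (Fin 6 → ℝ) → ℝ,
    (∀ᶠ m in 𝓝 ℓ, HasFDerivAt F (covector fun e => g e m) m) ∧ (∀ e, g e ℓ = 0) ∧
      ∀ e, HasFDerivAt (g e) (edgeForm p q r e) ℓ

namespace HasSecondOrder

variable {F : (Fin 6 → ℝ) → ℝ} {ℓ : Fin 6 → ℝ} {p q r : ℝ}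

theorem hasFDerivAt (h : HasSecondOrder F ℓ p q r) :
    HasFDerivAt F (0 : (Fin 6 → ℝ) →L[ℝ] ℝ) ℓ := by
  obtain ⟨g, hg, h0, -⟩ := h.exists_gradient
  refine hg.self_of_nhds.congr_fderiv ?_
  ext v
  simp [h0]

theorem isLittleO (h : HasSecondOrder F ℓ p q r) :
    (fun m => F m - F ℓ - (1 / 2) * (p * (∑ e, (m e - ℓ e)) ^ 2 +
      q * ∑ e, (m e - ℓ e) ^ 2 + r * ∑ e, (m e.rev - ℓ e.rev) * (m e - ℓ e))) =o[𝓝 ℓ]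
        fun m => ‖m - ℓ‖ ^ 2 := by
  obtain ⟨g, hg, h0, hd⟩ := h.exists_gradient
  have := isLittleO_sub_half_second_derivative hg (by ext v; simp [h0]) (hasFDerivAt_covector hd)
  refine this.congr_left fun m => ?_
  rw [sum_smulRight_apply]
  simp only [Pi.sub_apply, sq, mul_assoc]

theorem hessian_apply (h : HasSecondOrder F ℓ p q r) (e e' : Fin 6) :
    hessian F ℓ e e' = p + (if e = e' then q else 0) + if e = e'.rev then r else 0 := by
  obtain ⟨g, hg, -, hd⟩ := h.exists_gradient
  have h1 : partialDeriv F e' =ᶠ[𝓝 ℓ] g e' := by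
    filter_upwards [hg] with m hm
    rw [partialDeriv, hm.fderiv]
    simp [Pi.single_apply]
  rw [hessian, Matrix.of_apply, partialDeriv, h1.fderiv_eq, (hd e').fderiv]
  simp [Pi.single_apply, eq_comm]

theorem hessian_mulVec (h : HasSecondOrder F ℓ p q r) (v : Fin 6 → ℝ) (e : Fin 6) :
    Matrix.toLin' (hessian F ℓ) v e = p * ∑ i, v i + q * v e + r * v e.rev := by
  rw [Matrix.toLin'_apply, Matrix.mulVec, dotProduct]
  simp only [h.hessian_apply]
  fin_cases e <;>
  · simp [Fin.sum_univ_six, Fin.rev]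
    ring

end HasSecondOrder

/-- Together with `mem_V₂` and `mem_V₀` this describes the eigenspaces by behaviour under exchange
of opposite edges, which is how the Hessian sees them. -/
theorem mem_V₁ (v : Fin 6 → ℝ) : v ∈ V₁ ↔ ∀ e : Fin 6, v e.rev = -v e := by
  rw [V₁, Submodule.mem_span_triple]
  constructor
  · rintro ⟨a, b, c, rfl⟩ e
    fin_cases e <;> simp [Fin.rev]
  · intro h
    refine ⟨v 0, v 1, v 2, ?_⟩
    have h0 : v 5 = _ := h 0
    have h1 : v 4 = _ := h 1
    have h2 : v 3 = _ := h 2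
    ext e
    fin_cases e <;> simp [h0, h1, h2]

theorem mem_V₂ (v : Fin 6 → ℝ) : v ∈ V₂ ↔ (∀ e : Fin 6, v e.rev = v e) ∧ ∑ e, v e = 0 := by
  rw [V₂, Submodule.mem_span_pair]
  constructor
  · rintro ⟨a, b, rfl⟩
    refine ⟨fun e => ?_, ?_⟩
    · fin_cases e <;> simp [Fin.rev]
    · simp [Fin.sum_univ_six]
      ring
  · rintro ⟨h, hs⟩
    refine ⟨(v 1 - v 2) / 2, v 0, ?_⟩
    have h0 : v 5 = _ := h 0
    have h1 : v 4 = _ := h 1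
    have h2 : v 3 = _ := h 2
    rw [Fin.sum_univ_six, h0, h1, h2] at hs
    ext e
    fin_cases e <;> simp [h0, h1, h2] <;> linarith

theorem mem_V₀ (v : Fin 6 → ℝ) : v ∈ V₀ ↔ ∀ e, v e = v 0 := by
  rw [V₀, Submodule.mem_span_singleton]
  constructor
  · rintro ⟨a, rfl⟩ e
    fin_cases e <;> simp
  · intro h
    refine ⟨v 0, ?_⟩
    ext e
    rw [h e]
    fin_cases e <;> simp

theorem finrank_V₁ : Module.finrank ℝ V₁ = 3 := by
  have hli : LinearIndependent ℝ (![![1, 0, 0, 0, 0, -1], ![0, 1, 0, 0, -1, 0],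
      ![0, 0, 1, -1, 0, 0]] : Fin 3 → Fin 6 → ℝ) := by
    rw [Fintype.linearIndependent_iff]
    intro g hg
    have h0 := congrFun hg 0
    have h1 := congrFun hg 1
    have h2 := congrFun hg 2
    simp [Fin.sum_univ_three] at h0 h1 h2
    intro i
    fin_cases i <;> assumption
  have := finrank_span_eq_card hli
  refine Eq.trans (congrArg (fun s => Module.finrank ℝ (Submodule.span ℝ s)) ?_) this
  ext x
  simp [eq_comm (a := x)]
  tauto

theorem finrank_V₂ : Module.finrank ℝ V₂ = 2 := by
  have hli : LinearIndependent ℝ (![![0, 1, -1, -1, 1, 0],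
      ![1, -1 / 2, -1 / 2, -1 / 2, -1 / 2, 1]] : Fin 2 → Fin 6 → ℝ) := by
    rw [Fintype.linearIndependent_iff]
    intro g hg
    have h0 := congrFun hg 0
    have h1 := congrFun hg 1
    simp [Fin.sum_univ_two] at h0 h1
    simp [h0] at h1
    intro i
    fin_cases i <;> assumption
  have := finrank_span_eq_card hli
  refine Eq.trans (congrArg (fun s => Module.finrank ℝ (Submodule.span ℝ s)) ?_) this
  ext x
  simp [eq_comm (a := x)]
  tauto

theorem finrank_V₀ : Module.finrank ℝ V₀ = 1 := by
  refine finrank_span_singleton fun h => ?_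
  simpa using congrFun h 0

/-- In the eigenvector equation, summing all rows gives μ ∑ v = 0. Subtracting the rows of opposite
edges gives (μ - a)(v_e - v_e') = 0, and adding them, once ∑ v = 0, gives (μ - b)(v_e + v_e') = 0.
-/
theorem HasSecondOrder.hasHessianEigendata {F : (Fin 6 → ℝ) → ℝ} {ℓ : Fin 6 → ℝ} {p q r a b : ℝ}
    (h : HasSecondOrder F ℓ p q r) (hF : ContDiffAt ℝ 2 F ℓ) (h0 : 6 * p + q + r = 0)
    (ha : q - r = a) (hb : q + r = b) (ha0 : a ≠ 0) (hb0 : b ≠ 0) (hab : a ≠ b) :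
    HasHessianEigendata F ℓ a b := by
  have hmem : ∀ (μ : ℝ) (v : Fin 6 → ℝ),
      v ∈ Module.End.eigenspace (Matrix.toLin' (hessian F ℓ)) μ ↔
        ∀ e, p * ∑ i, v i + q * v e + r * v e.rev = μ * v e := by
    intro μ v
    rw [Module.End.mem_eigenspace_iff, funext_iff]
    simp only [h.hessian_mulVec, Pi.smul_apply, smul_eq_mul]
  have hsum : ∀ (μ : ℝ) (v : Fin 6 → ℝ), μ ≠ 0 →
      (∀ e, p * ∑ i, v i + q * v e + r * v e.rev = μ * v e) → ∑ i, v i = 0 := by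
    intro μ v hμ hv
    have h1 : ∑ e, (p * ∑ i, v i + q * v e + r * v e.rev) = ∑ e, μ * v e :=
      Finset.sum_congr rfl fun e _ => hv e
    have h2 : ∑ e : Fin 6, v e.rev = ∑ e, v e := Equiv.sum_comp Fin.revPerm v
    rw [Finset.sum_add_distrib, Finset.sum_add_distrib, ← Finset.mul_sum, ← Finset.mul_sum,
      ← Finset.mul_sum, ← Finset.mul_sum, h2, Finset.sum_const, Finset.card_univ, Fintype.card_fin,
      nsmul_eq_mul] at h1
    apply mul_left_cancel₀ hμ
    push_cast at h1
    linear_combination -h1 + h0 * ∑ i, v i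
  have hdiff : ∀ (μ : ℝ) (v : Fin 6 → ℝ),
      (∀ e, p * ∑ i, v i + q * v e + r * v e.rev = μ * v e) → μ ≠ a → ∀ e, v e.rev = v e := by
    intro μ v hv hμ e
    have h1 := hv e
    have h2 := hv e.rev
    rw [Fin.rev_rev] at h2
    apply mul_left_cancel₀ (sub_ne_zero.2 hμ)
    rw [← ha]
    linear_combination h1 - h2
  have hadd : ∀ (μ : ℝ) (v : Fin 6 → ℝ), μ ≠ 0 →
      (∀ e, p * ∑ i, v i + q * v e + r * v e.rev = μ * v e) → μ ≠ b → ∀ e, v e.rev = -v e := by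
    intro μ v hμ0 hv hμ e
    have h1 := hv e
    have h2 := hv e.rev
    rw [hsum μ v hμ0 hv] at h1 h2
    rw [Fin.rev_rev] at h2
    apply mul_left_cancel₀ (sub_ne_zero.2 hμ)
    rw [← hb]
    linear_combination -h1 - h2
  have e1 : Module.End.eigenspace (Matrix.toLin' (hessian F ℓ)) a = V₁ := by
    ext v
    rw [hmem, mem_V₁]
    refine ⟨fun hv => hadd a v ha0 hv hab, fun hv e => ?_⟩
    have hS : ∑ i, v i = 0 := by
      have h2 : ∑ e : Fin 6, v e.rev = ∑ e, v e := Equiv.sum_comp Fin.revPerm v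
      simp only [hv, Finset.sum_neg_distrib] at h2
      linarith
    rw [hS, hv, ← ha]
    ring
  have e2 : Module.End.eigenspace (Matrix.toLin' (hessian F ℓ)) b = V₂ := by
    ext v
    rw [hmem, mem_V₂]
    refine ⟨fun hv => ⟨hdiff b v hv hab.symm, hsum b v hb0 hv⟩, fun ⟨hv, hS⟩ e => ?_⟩
    rw [hS, hv, ← hb]
    ring
  have e3 : Module.End.eigenspace (Matrix.toLin' (hessian F ℓ)) 0 = V₀ := by
    ext v
    rw [hmem, mem_V₀]
    refine ⟨fun hv e => ?_, fun hv e => ?_⟩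
    · have hr := hdiff 0 v hv ha0.symm
      have h1 := hv e
      have h2 := hv 0
      rw [hr] at h1 h2
      apply mul_left_cancel₀ hb0
      rw [← hb]
      linear_combination h1 - h2
    · rw [Fin.sum_univ_six, hv 1, hv 2, hv 3, hv 4, hv 5, hv e, hv e.rev]
      linear_combination h0 * v 0
  refine ⟨hF, e1, finrank_V₁, e2, finrank_V₂, e3, finrank_V₀, fun μ => ⟨fun hμ => ?_, ?_⟩⟩
  · obtain ⟨v, hv, hv0⟩ := hμ.exists_hasEigenvector
    rw [hmem] at hv
    -- For any other μ the eigenvector would be both even and odd under the exchange, hence zero.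
    by_contra! hne
    refine hv0 (funext fun e => ?_)
    have h1 := hdiff μ v hv hne.1 e
    have h2 := hadd μ v hne.2.2 hv hne.2.1 e
    change v e = 0
    linarith
  · have hbot : ∀ W : Submodule ℝ (Fin 6 → ℝ), Module.finrank ℝ W ≠ 0 → W ≠ ⊥ := by
      rintro W hW rfl
      simp at hW
    rw [Module.End.hasEigenvalue_iff]
    rintro (rfl | rfl | rfl)
    · rw [e1]; exact hbot _ (by rw [finrank_V₁]; norm_num)
    · rw [e2]; exact hbot _ (by rw [finrank_V₂]; norm_num)
    · rw [e3]; exact hbot _ (by rw [finrank_V₀]; norm_num)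

/-! ### Second derivative tests -/

/-- A negative second variation excludes a local minimum. -/
theorem HasSecondOrder.not_isLocalMinOn {F : (Fin 6 → ℝ) → ℝ} {ℓ : Fin 6 → ℝ} {p q r : ℝ}
    (h : HasSecondOrder F ℓ p q r) (hℓ : ℓ ∈ met) {v : Fin 6 → ℝ}
    (hv : p * (∑ e, v e) ^ 2 + q * ∑ e, v e ^ 2 + r * ∑ e : Fin 6, v e.rev * v e < 0) :
    ¬ IsLocalMinOn F met ℓ := by
  intro hmin
  rw [IsLocalMinOn, IsMinFilter, isOpen_met.nhdsWithin_eq hℓ] at hmin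
  have hlim : Filter.Tendsto (fun t : ℝ => ℓ + t • v) (𝓝[≠] 0) (𝓝 ℓ) := by
    have : Continuous fun t : ℝ => ℓ + t • v := by fun_prop
    have h0 := this.tendsto 0
    rw [zero_smul, add_zero] at h0
    exact h0.mono_left nhdsWithin_le_nhds
  set c := p * (∑ e, v e) ^ 2 + q * ∑ e, v e ^ 2 + r * ∑ e : Fin 6, v e.rev * v e with hc
  -- This keeps the remainder along ℓ + t v below t² |c| / 4, too small to offset the main term t² c
  -- / 2.
  have hε : 0 < -c / (4 * (‖v‖ ^ 2 + 1)) := by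
    have : 0 < -c := neg_pos.2 hv
    positivity
  have hO := hlim.eventually ((Asymptotics.isLittleO_iff.1 h.isLittleO) hε)
  obtain ⟨t, ⟨h1, h2⟩, ht⟩ := ((hlim.eventually hmin).and hO |>.and self_mem_nhdsWithin).exists
  have ht0 : 0 < t ^ 2 := by
    have : t ≠ 0 := ht
    positivity
  have hq : p * (∑ e, ((ℓ + t • v) e - ℓ e)) ^ 2 + q * ∑ e, ((ℓ + t • v) e - ℓ e) ^ 2 +
      r * ∑ e : Fin 6, ((ℓ + t • v) e.rev - ℓ e.rev) * ((ℓ + t • v) e - ℓ e) = t ^ 2 * c := by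
    rw [hc]
    simp [Fin.sum_univ_six]
    ring
  have hn : ‖‖ℓ + t • v - ℓ‖ ^ 2‖ = t ^ 2 * ‖v‖ ^ 2 := by
    rw [add_sub_cancel_left, norm_smul, mul_pow, Real.norm_eq_abs t, sq_abs, Real.norm_eq_abs,
      abs_of_nonneg (by positivity)]
  rw [hq, hn] at h2
  have h3 := (le_abs_self _).trans h2
  have h4 : -c / (4 * (‖v‖ ^ 2 + 1)) * (‖v‖ ^ 2 + 1) = -c / 4 := by field_simp
  have h5 : t ^ 2 * (-c / 2) ≤ t ^ 2 * (-c / (4 * (‖v‖ ^ 2 + 1)) * ‖v‖ ^ 2) := by linarith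
  have h6 := le_of_mul_le_mul_left h5 ht0
  linarith

theorem HasSecondOrder.neg {F : (Fin 6 → ℝ) → ℝ} {ℓ : Fin 6 → ℝ} {p q r : ℝ}
    (h : HasSecondOrder F ℓ p q r) : HasSecondOrder (-F) ℓ (-p) (-q) (-r) := by
  obtain ⟨g, hg, h0, hd⟩ := h.exists_gradient
  refine ⟨fun e m => -g e m, ?_, fun e => by simp [h0], fun e => ?_⟩
  · filter_upwards [hg] with m hm
    refine hm.neg.congr_fderiv ?_
    ext v
    simp
  · refine (hd e).neg.congr_fderiv ?_
    ext v
    simp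
    ring

/-- A positive second variation excludes a local maximum. -/
theorem HasSecondOrder.not_isLocalMaxOn {F : (Fin 6 → ℝ) → ℝ} {ℓ : Fin 6 → ℝ} {p q r : ℝ}
    (h : HasSecondOrder F ℓ p q r) (hℓ : ℓ ∈ met) {v : Fin 6 → ℝ}
    (hv : 0 < p * (∑ e, v e) ^ 2 + q * ∑ e, v e ^ 2 + r * ∑ e : Fin 6, v e.rev * v e) :
    ¬ IsLocalMaxOn F met ℓ := fun hmax =>
  h.neg.not_isLocalMinOn hℓ (v := v) (by linarith) hmax.neg

theorem norm_sq_le_sum_sq (v : Fin 6 → ℝ) : ‖v‖ ^ 2 ≤ ∑ e, v e ^ 2 := by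
  obtain ⟨e, -, he⟩ := Finset.exists_mem_eq_sup' Finset.univ_nonempty fun e => ‖v e‖₊
  have h1 : ‖v‖ = |v e| := by
    rw [Pi.norm_def, ← Finset.sup'_eq_sup Finset.univ_nonempty, he]
    rfl
  rw [h1, sq_abs]
  exact Finset.single_le_sum (f := fun e => v e ^ 2) (fun i _ => sq_nonneg _) (Finset.mem_univ e)

/-- The second derivative test transversally to the scaling direction. -/
theorem HasSecondOrder.eventually_le {F : (Fin 6 → ℝ) → ℝ} {ℓ : Fin 6 → ℝ} {p q r : ℝ}
    (h : HasSecondOrder F ℓ p q r) (ha : 0 < q - r) (hb : 0 < q + r) :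
    ∀ᶠ m in 𝓝 ℓ, ∑ e, m e = ∑ e, ℓ e → F ℓ ≤ F m := by
  obtain ⟨c, hc, hca, hcb⟩ : ∃ c, 0 < c ∧ c ≤ q - r ∧ c ≤ q + r :=
    ⟨min (q - r) (q + r), lt_min ha hb, min_le_left _ _, min_le_right _ _⟩
  filter_upwards [Asymptotics.isLittleO_iff.1 h.isLittleO (half_pos hc)] with m hm hsum
  obtain ⟨d, hd⟩ : ∃ d : Fin 6 → ℝ, d = m - ℓ := ⟨_, rfl⟩
  have hd' : ∀ e, m e - ℓ e = d e := fun e => by rw [hd]; rfl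
  have hS : ∑ e, d e = 0 := by
    simp only [← hd', Finset.sum_sub_distrib, hsum, sub_self]
  rw [← hd] at hm
  simp only [hd', hS] at hm
  rw [Real.norm_eq_abs (‖d‖ ^ 2), abs_of_nonneg (by positivity)] at hm
  have h1 := (neg_le_abs _).trans hm
  have h2 := norm_sq_le_sum_sq d
  have h3 : c * ∑ e, d e ^ 2 ≤ q * ∑ e, d e ^ 2 + r * ∑ e : Fin 6, d e.rev * d e := by
    -- On a pair of opposite edges the difference of the two sides is ½(q - r - c)(x - y)² + ½(q + r
    -- - c)(x + y)².
    have key : ∀ x y : ℝ, c * (x ^ 2 + y ^ 2) ≤ q * (x ^ 2 + y ^ 2) + 2 * r * (x * y) := by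
      intro x y
      nlinarith [mul_nonneg (sub_nonneg.2 hca) (sq_nonneg (x - y)),
        mul_nonneg (sub_nonneg.2 hcb) (sq_nonneg (x + y))]
    have k0 := key (d 0) (d 5)
    have k1 := key (d 1) (d 4)
    have k2 := key (d 2) (d 3)
    simp [Fin.sum_univ_six, Fin.rev]
    linarith
  have h4 := mul_le_mul_of_nonneg_left h2 hc.le
  linarith

/-! ### Second order data of a normalized functional -/

/-- Treats both normalizations at once: U is the reciprocal of the denominator, and m is the
logarithmic gradient of the denominator. -/
theorem hasFDerivAt_EHR_mul {U : (Fin 6 → ℝ) → ℝ} {ℓ m : Fin 6 → ℝ} (h : IsNondegenerate ℓ)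
    (hU : HasFDerivAt U (covector fun e => -(U ℓ * m e)) ℓ) :
    HasFDerivAt (fun x => EHR x * U x)
      (covector fun e => U ℓ * (2 * Real.pi - 2 * dihedral ℓ e - EHR ℓ * m e)) ℓ := by
  refine ((hasFDerivAt_EHR h).fun_mul hU).congr_fderiv ?_
  ext v
  simp [Fin.sum_univ_six]
  ring

theorem EHR_equalLength {k : ℝ} (hk : 0 < k) :
    EHR (equalLength k) = 6 * k * (2 * Real.pi - 2 * Real.arccos (1 / 3)) := by
  simp only [EHR, edgeCurvature_eq, dihedral_equalLength hk, equalLength, Finset.sum_const,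
    Finset.card_univ, Fintype.card_fin, nsmul_eq_mul]
  push_cast
  ring

/-- At ℓ_k the bracket in the gradient U (2π - 2β_e - EHR m_e) vanishes, so the derivative of U
drops out and only first derivatives of β_e, EHR and m_e enter. -/
theorem hasSecondOrder_EHR_mul {k : ℝ} (hk : 0 < k) {U : (Fin 6 → ℝ) → ℝ}
    {m : Fin 6 → (Fin 6 → ℝ) → ℝ} {p q r : ℝ}
    (hU : ∀ᶠ ℓ in 𝓝 (equalLength k), HasFDerivAt U (covector fun e => -(U ℓ * m e ℓ)) ℓ)
    (hm0 : ∀ e, m e (equalLength k) = 1 / (6 * k))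
    (hm : ∀ e, HasFDerivAt (m e) (edgeForm p q r e) (equalLength k)) :
    HasSecondOrder (fun ℓ => EHR ℓ * U ℓ) (equalLength k)
      (U (equalLength k) * (2 * Real.sqrt 2 / (3 * k) -
        (2 * Real.pi - 2 * Real.arccos (1 / 3)) * (1 / (6 * k) + 6 * k * p)))
      (U (equalLength k) * (-(4 * Real.sqrt 2) / (3 * k) -
        (2 * Real.pi - 2 * Real.arccos (1 / 3)) * (6 * k * q)))
      (U (equalLength k) * (-(8 * Real.sqrt 2) / (3 * k) -
        (2 * Real.pi - 2 * Real.arccos (1 / 3)) * (6 * k * r))) := by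
  have hnd := isNondegenerate_equalLength hk
  refine ⟨fun e ℓ => U ℓ * (2 * Real.pi - 2 * dihedral ℓ e - EHR ℓ * m e ℓ), ?_, fun e => ?_,
    fun e => ?_⟩
  · filter_upwards [hU, eventually_isNondegenerate hnd] with ℓ h1 h2
    exact hasFDerivAt_EHR_mul h2 h1
  · simp only [EHR_equalLength hk, dihedral_equalLength hk, hm0]
    field_simp
    ring
  · refine ((hU.self_of_nhds).fun_mul ((((hasFDerivAt_dihedral_equalLength hk e).const_mul
      2).const_sub (2 * Real.pi)).fun_sub ((hasFDerivAt_EHR hnd).fun_mul (hm e)))).congr_fderiv ?_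
    ext v
    simp only [EHR_equalLength hk, dihedral_equalLength hk, hm0, add_apply, smul_apply, neg_apply,
      sub_apply, covector_apply, edgeForm_apply, smul_eq_mul, sum_apply,
      ContinuousLinearMap.proj_apply, ← Finset.mul_sum]
    field_simp
    ring

theorem contDiffAt_dihedral_equalLength {k : ℝ} (hk : 0 < k) (e : Fin 6) :
    ContDiffAt ℝ 2 (fun ℓ => dihedral ℓ e) (equalLength k) := by
  have hnd := isNondegenerate_equalLength hk
  have h1 : ContDiffAt ℝ 2 (fun ℓ => Real.arccos (cosNumer e ℓ /
      (Real.sqrt (faceHeron (edgeEnds e.rev).2 ℓ) *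
        Real.sqrt (faceHeron (edgeEnds e.rev).1 ℓ)))) (equalLength k) := by
    refine (Real.contDiffAt_arccos ?_ ?_).comp (equalLength k)
      ((contDiff_cosNumer e).contDiffAt.div
      (((contDiff_faceHeron _).contDiffAt.sqrt (hnd.face _).ne').mul
        ((contDiff_faceHeron _).contDiffAt.sqrt (hnd.face _).ne')) ?_)
    · rw [cosNumer_equalLength, faceHeron_equalLength, faceHeron_equalLength,
        Real.mul_self_sqrt (by positivity)]
      have : 0 < k ^ 4 / (3 * k ^ 4) := by positivity
      linarith
    · rw [cosNumer_equalLength, faceHeron_equalLength, faceHeron_equalLength,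
        Real.mul_self_sqrt (by positivity)]
      field_simp
      norm_num
    · exact (mul_pos (Real.sqrt_pos.2 (hnd.face _)) (Real.sqrt_pos.2 (hnd.face _))).ne'
  refine h1.congr_of_eventuallyEq ?_
  filter_upwards [eventually_isNondegenerate hnd] with ℓ hℓ using dihedral_eq hℓ e

theorem contDiffAt_EHR_equalLength {k : ℝ} (hk : 0 < k) :
    ContDiffAt ℝ 2 EHR (equalLength k) := by
  have hE : EHR = fun m => ∑ e, (2 * Real.pi - 2 * dihedral m e) * m e := by
    funext m
    simp only [EHR, edgeCurvature_eq]
  rw [hE]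
  refine ContDiffAt.sum fun e _ => ?_
  exact (contDiffAt_const.sub (contDiffAt_const.mul (contDiffAt_dihedral_equalLength hk e))).mul
    (contDiff_apply ℝ ℝ e).contDiffAt

/-- With `sqrt_two_lt`, this crude bound suffices to make the two nonzero VEHR eigenvalues positive
and distinct. -/
theorem pi_sub_arccos_bound : 3 / 2 < Real.pi - Real.arccos (1 / 3) := by
  have h1 : Real.arccos (1 / 3) ≤ Real.pi / 2 := Real.arccos_le_pi_div_two.2 (by norm_num)
  linarith [Real.pi_gt_three]

theorem sqrt_two_lt : Real.sqrt 2 < 3 / 2 := by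
  rw [Real.sqrt_lt' (by norm_num)]
  norm_num

/-! ### The length normalized functional -/

theorem totalLength_eq_covector (ℓ : Fin 6 → ℝ) : totalLength ℓ = covector 1 ℓ := by
  simp [totalLength]

theorem hasFDerivAt_totalLength (ℓ : Fin 6 → ℝ) : HasFDerivAt totalLength (covector 1) ℓ := by
  rw [funext totalLength_eq_covector]
  exact (covector 1).hasFDerivAt

theorem IsNondegenerate.totalLength_pos {ℓ : Fin 6 → ℝ} (h : IsNondegenerate ℓ) :
    0 < totalLength ℓ :=
  Finset.sum_pos (fun e _ => h.pos e) Finset.univ_nonempty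

theorem hasFDerivAt_inv_totalLength {ℓ : Fin 6 → ℝ} (h : IsNondegenerate ℓ) :
    HasFDerivAt (fun m => (totalLength m)⁻¹)
      (covector fun _ => -((totalLength ℓ)⁻¹ * (totalLength ℓ)⁻¹)) ℓ := by
  refine ((hasDerivAt_inv h.totalLength_pos.ne').comp_hasFDerivAt ℓ
    (hasFDerivAt_totalLength ℓ)).congr_fderiv ?_
  ext v
  simp [Finset.mul_sum, sq]

theorem LEHR_eq : LEHR = fun ℓ => EHR ℓ * (totalLength ℓ)⁻¹ := rfl

theorem hasFDerivAt_LEHR {ℓ : Fin 6 → ℝ} (h : IsNondegenerate ℓ) :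
    HasFDerivAt LEHR (covector fun e => (totalLength ℓ)⁻¹ *
      (2 * Real.pi - 2 * dihedral ℓ e - EHR ℓ * (totalLength ℓ)⁻¹)) ℓ :=
  hasFDerivAt_EHR_mul h (hasFDerivAt_inv_totalLength h)

theorem totalLength_equalLength (k : ℝ) : totalLength (equalLength k) = 6 * k := by
  simp [totalLength, equalLength]

theorem hasSecondOrder_LEHR {k : ℝ} (hk : 0 < k) :
    HasSecondOrder LEHR (equalLength k) (Real.sqrt 2 / (9 * k ^ 2))
      (-(2 * Real.sqrt 2) / (9 * k ^ 2)) (-(4 * Real.sqrt 2) / (9 * k ^ 2)) := by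
  have hnd := isNondegenerate_equalLength hk
  have h := hasSecondOrder_EHR_mul hk (U := fun ℓ => (totalLength ℓ)⁻¹)
    (m := fun _ ℓ => (totalLength ℓ)⁻¹) (p := -1 / (36 * k ^ 2)) (q := 0) (r := 0) ?_ ?_ ?_
  · rw [LEHR_eq]
    convert h using 1 <;>
    · rw [totalLength_equalLength]
      field_simp
      ring
  · filter_upwards [eventually_isNondegenerate hnd] with ℓ hℓ using hasFDerivAt_inv_totalLength hℓ
  · intro e
    simp [totalLength_equalLength]
  · intro e
    refine (hasFDerivAt_inv_totalLength hnd).congr_fderiv ?_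
    ext v
    simp only [totalLength_equalLength, covector_apply, edgeForm_apply, ← Finset.mul_sum]
    field_simp
    ring

theorem hasHessianEigendata_LEHR {k : ℝ} (hk : 0 < k) :
    HasHessianEigendata LEHR (equalLength k) (2 * Real.sqrt 2 / 9 * (k ^ 2)⁻¹)
      (-(2 * Real.sqrt 2 / 3) * (k ^ 2)⁻¹) := by
  have hs : 0 < Real.sqrt 2 := by positivity
  have hk2 : 0 < (k ^ 2)⁻¹ := by positivity
  have ha : 0 < 2 * Real.sqrt 2 / 9 * (k ^ 2)⁻¹ := by positivity
  have hb : -(2 * Real.sqrt 2 / 3) * (k ^ 2)⁻¹ < 0 := by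
    rw [neg_mul, neg_lt_zero]
    positivity
  refine (hasSecondOrder_LEHR hk).hasHessianEigendata ?_ ?_ ?_ ?_ ha.ne' hb.ne (hb.trans ha).ne'
  · refine (contDiffAt_EHR_equalLength hk).div ?_ ?_
    · rw [funext totalLength_eq_covector]
      exact (covector 1).contDiff.contDiffAt
    · exact (isNondegenerate_equalLength hk).totalLength_pos.ne'
  all_goals
    field_simp
    ring

theorem isCritical_LEHR_equalLength {k : ℝ} (hk : 0 < k) : IsCritical LEHR (equalLength k) :=
  ⟨mem_met_iff.2 (isNondegenerate_equalLength hk), (hasSecondOrder_LEHR hk).hasFDerivAt⟩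

theorem isCritical_LEHR_iff (ℓ : Fin 6 → ℝ) :
    IsCritical LEHR ℓ ↔ ∃ k : ℝ, 0 < k ∧ ℓ = equalLength k := by
  refine ⟨fun ⟨hm, hd⟩ => ?_, fun ⟨k, hk, h⟩ => h ▸ isCritical_LEHR_equalLength hk⟩
  have h := mem_met_iff.1 hm
  have hcov := (hasFDerivAt_LEHR h).unique hd
  refine eq_equalLength_of_dihedral_eq h
    (β := (2 * Real.pi - EHR ℓ * (totalLength ℓ)⁻¹) / 2) fun e => ?_
  have he := congrArg (fun L => L (Pi.single e 1)) hcov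
  simp [Pi.single_apply, h.totalLength_pos.ne'] at he
  linarith

theorem isSaddle_LEHR_equalLength {k : ℝ} (hk : 0 < k) : IsSaddle LEHR (equalLength k) := by
  have hm := mem_met_iff.2 (isNondegenerate_equalLength hk)
  have h := hasSecondOrder_LEHR hk
  refine ⟨isCritical_LEHR_equalLength hk,
    -- The test vectors are taken from `V₂`, where the second variation is negative, and from `V₁`,
    -- where it is positive.
    h.not_isLocalMinOn hm (v := ![0, 1, -1, -1, 1, 0]) ?_,
    h.not_isLocalMaxOn hm (v := ![1, 0, 0, 0, 0, -1]) ?_⟩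
  · have : 0 < Real.sqrt 2 / (9 * k ^ 2) := by positivity
    simp [Fin.sum_univ_six, Fin.rev, neg_div, mul_div_assoc]
    linarith
  · have : 0 < Real.sqrt 2 / (9 * k ^ 2) := by positivity
    simp [Fin.sum_univ_six, Fin.rev, neg_div, mul_div_assoc]
    linarith

/-! ### The volume normalized functional -/

theorem volume_eq (ℓ : Fin 6 → ℝ) : volume ℓ = 2 * Real.sqrt (cayleyMenger ℓ / 288) := by
  simp [volume, tetVolume]

theorem hasFDerivAt_volume {ℓ : Fin 6 → ℝ} (h : IsNondegenerate ℓ) :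
    HasFDerivAt volume
      (covector fun e => ℓ e * cosNumer e.rev ℓ / (72 * Real.sqrt (cayleyMenger ℓ / 288))) ℓ := by
  rw [funext volume_eq]
  have hpos : 0 < cayleyMenger ℓ / 288 := div_pos h.cm (by norm_num)
  refine ((((hasFDerivAt_cayleyMenger ℓ).mul_const (288⁻¹ : ℝ)).sqrt hpos.ne').const_mul
    2).congr_fderiv ?_
  ext v
  simp only [smul_apply, covector_apply, smul_eq_mul, Finset.mul_sum, ← div_eq_mul_inv]
  refine Finset.sum_congr rfl fun e _ => ?_
  have := Real.sqrt_pos.2 hpos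
  field_simp
  ring

theorem isVEinstein_equalLength {k : ℝ} (hk : 0 < k) : IsVEinstein (equalLength k) := by
  have hnd := isNondegenerate_equalLength hk
  obtain ⟨w, hw0, hw⟩ : ∃ w : ℝ, 0 < w ∧ ∀ e, partialDeriv volume e (equalLength k) = w := by
    refine ⟨k * k ^ 4 / (72 * Real.sqrt (cayleyMenger (equalLength k) / 288)), ?_, fun e => ?_⟩
    · have := Real.sqrt_pos.2 (div_pos hnd.cm (by norm_num : (0 : ℝ) < 288))
      positivity
    · rw [partialDeriv, (hasFDerivAt_volume hnd).fderiv]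
      simp [Pi.single_apply, cosNumer_equalLength, equalLength]
  refine ⟨mem_met_iff.2 hnd, (2 * Real.pi - 2 * Real.arccos (1 / 3)) / w, fun e => ?_⟩
  rw [edgeCurvature_eq, dihedral_equalLength hk, hw]
  field_simp

/-- The normalizing factor `𝓥 ^ (-1/3)`. -/
def volumeFactor (ℓ : Fin 6 → ℝ) : ℝ :=
  (cayleyMenger ℓ / 72) ^ (-(1 / 6) : ℝ)

theorem VEHR_eq {ℓ : Fin 6 → ℝ} (h : IsNondegenerate ℓ) : VEHR ℓ = EHR ℓ * volumeFactor ℓ := by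
  have hpos : 0 ≤ cayleyMenger ℓ / 72 := (div_pos h.cm (by norm_num)).le
  have hv : volume ℓ = (cayleyMenger ℓ / 72) ^ (1 / 2 : ℝ) := by
    rw [← Real.sqrt_eq_rpow, volume_eq, eq_comm, Real.sqrt_eq_iff_eq_sq hpos (by positivity),
      mul_pow, Real.sq_sqrt (div_pos h.cm (by norm_num)).le]
    ring
  rw [VEHR, hv, ← Real.rpow_mul hpos, volumeFactor, Real.rpow_neg hpos, div_eq_mul_inv]
  norm_num

/-- The logarithmic derivative of `𝓥 ^ (1/3)`. -/
def volumeCoeff (e : Fin 6) (ℓ : Fin 6 → ℝ) : ℝ :=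
  2 * ℓ e * cosNumer e.rev ℓ * (3 * cayleyMenger ℓ)⁻¹

theorem hasFDerivAt_volumeFactor {ℓ : Fin 6 → ℝ} (h : IsNondegenerate ℓ) :
    HasFDerivAt volumeFactor (covector fun e => -(volumeFactor ℓ * volumeCoeff e ℓ)) ℓ := by
  have hD := h.cm
  have hpos : 0 < cayleyMenger ℓ / 72 := div_pos h.cm (by norm_num)
  refine (((hasFDerivAt_cayleyMenger ℓ).mul_const (72⁻¹ : ℝ)).rpow_const (p := -(1 / 6))
    (Or.inl hpos.ne')).congr_fderiv ?_
  ext v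
  simp only [smul_apply, covector_apply, smul_eq_mul, Finset.mul_sum, ← div_eq_mul_inv]
  refine Finset.sum_congr rfl fun e _ => ?_
  rw [Real.rpow_sub_one hpos.ne', volumeCoeff, volumeFactor]
  field_simp
  ring

/-- Here 6p + q + r = -1 / (6k²), in accordance with homogeneity of degree -1 and the value 1 / (6k)
at ℓ_k. -/
theorem hasFDerivAt_volumeCoeff_equalLength {k : ℝ} (hk : 0 < k) (e : Fin 6) :
    HasFDerivAt (volumeCoeff e)
      (edgeForm (1 / (6 * k ^ 2)) (-5 / (6 * k ^ 2)) (-2 / (6 * k ^ 2)) e) (equalLength k) := by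
  have hnd := isNondegenerate_equalLength hk
  have hD : 3 * cayleyMenger (equalLength k) ≠ 0 := (mul_pos three_pos hnd.cm).ne'
  refine ((((ContinuousLinearMap.proj (R := ℝ) (φ := fun _ : Fin 6 => ℝ) e).hasFDerivAt.const_mul
    2).fun_mul (hasFDerivAt_cosNumer_equalLength k e.rev)).fun_mul
      ((hasDerivAt_inv hD).comp_hasFDerivAt (equalLength k)
        ((hasFDerivAt_cayleyMenger _).const_mul 3))).congr_fderiv ?_
  ext v
  simp only [cosNumer_equalLength, add_apply, smul_apply, Function.comp,
    covector_apply, edgeForm_apply, smul_eq_mul, cayleyMenger_equalLength, equalLength,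
    ContinuousLinearMap.proj_apply, ← Finset.mul_sum, Fin.rev_rev]
  field_simp
  ring

theorem volumeFactor_equalLength {k : ℝ} (hk : 0 < k) :
    volumeFactor (equalLength k) = (2 : ℝ) ^ (1 / 6 : ℝ) * (3 : ℝ) ^ (1 / 3 : ℝ) / k := by
  have h2 : ((2 : ℝ) ^ (1 / 6 : ℝ)) ^ 6 = 2 := by
    rw [← Real.rpow_natCast, ← Real.rpow_mul (by norm_num)]
    norm_num
  have h3 : ((3 : ℝ) ^ (1 / 3 : ℝ)) ^ 6 = 9 := by
    rw [← Real.rpow_natCast, ← Real.rpow_mul (by norm_num)]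
    norm_num
  -- Since D / 72 = k⁶ / 18, the factor is the sixth root of 18 divided by k.
  obtain ⟨w, hw⟩ : ∃ w, w = (2 : ℝ) ^ (1 / 6 : ℝ) * (3 : ℝ) ^ (1 / 3 : ℝ) / k := ⟨_, rfl⟩
  have hw0 : 0 < w := by rw [hw]; positivity
  have h6 : cayleyMenger (equalLength k) / 72 = w ^ (-6 : ℝ) := by
    rw [cayleyMenger_equalLength, Real.rpow_neg hw0.le, show (6 : ℝ) = ((6 : ℕ) : ℝ) by norm_num,
      Real.rpow_natCast, hw, div_pow, mul_pow, h2, h3]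
    field_simp
    norm_num
  rw [← hw, volumeFactor, h6, ← Real.rpow_mul hw0.le]
  norm_num

theorem HasSecondOrder.congr_of_eventuallyEq {F G : (Fin 6 → ℝ) → ℝ} {ℓ : Fin 6 → ℝ}
    {p q r : ℝ} (h : HasSecondOrder F ℓ p q r) (hG : G =ᶠ[𝓝 ℓ] F) : HasSecondOrder G ℓ p q r := by
  obtain ⟨g, hg, hrest⟩ := h.exists_gradient
  refine ⟨g, ?_, hrest⟩
  filter_upwards [hg, hG.eventually_nhds] with m h1 h2 using h1.congr_of_eventuallyEq h2

theorem hasSecondOrder_VEHR {k : ℝ} (hk : 0 < k) :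
    HasSecondOrder VEHR (equalLength k)
      (volumeFactor (equalLength k) / k * (2 * Real.sqrt 2 / 3 -
        7 / 3 * (Real.pi - Real.arccos (1 / 3))))
      (volumeFactor (equalLength k) / k * (-(4 * Real.sqrt 2) / 3 +
        10 * (Real.pi - Real.arccos (1 / 3))))
      (volumeFactor (equalLength k) / k * (-(8 * Real.sqrt 2) / 3 +
        4 * (Real.pi - Real.arccos (1 / 3)))) := by
  have hnd := isNondegenerate_equalLength hk
  have h := hasSecondOrder_EHR_mul hk (U := volumeFactor) (m := volumeCoeff) ?_ (fun e => ?_)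
    (hasFDerivAt_volumeCoeff_equalLength hk)
  · have hV : VEHR =ᶠ[𝓝 (equalLength k)] fun ℓ => EHR ℓ * volumeFactor ℓ := by
      filter_upwards [eventually_isNondegenerate hnd] with ℓ hℓ using VEHR_eq hℓ
    convert h.congr_of_eventuallyEq hV using 1 <;>
    · field_simp
      ring
  · filter_upwards [eventually_isNondegenerate hnd] with ℓ hℓ using hasFDerivAt_volumeFactor hℓ
  · rw [volumeCoeff, cosNumer_equalLength, cayleyMenger_equalLength, equalLength]
    field_simp
    norm_num

theorem contDiffAt_VEHR_equalLength {k : ℝ} (hk : 0 < k) :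
    ContDiffAt ℝ 2 VEHR (equalLength k) := by
  have hnd := isNondegenerate_equalLength hk
  have h1 : ContDiffAt ℝ 2 (fun ℓ => EHR ℓ * volumeFactor ℓ) (equalLength k) :=
    (contDiffAt_EHR_equalLength hk).mul
      ((contDiff_cayleyMenger.contDiffAt.div_const 72).rpow_const_of_ne
        (div_pos hnd.cm (by norm_num)).ne')
  refine h1.congr_of_eventuallyEq ?_
  filter_upwards [eventually_isNondegenerate hnd] with ℓ hℓ using VEHR_eq hℓ

theorem hasHessianEigendata_VEHR {k : ℝ} (hk : 0 < k) :
    HasHessianEigendata VEHR (equalLength k)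
      ((2 : ℝ) ^ (7 / 6 : ℝ) * (3 : ℝ) ^ (-(2 / 3) : ℝ) * (k ^ 2)⁻¹ *
        ((2 : ℝ) ^ (3 / 2 : ℝ) + 9 * Real.pi - 9 * Real.arccos (1 / 3)))
      ((2 : ℝ) ^ (7 / 6 : ℝ) * (3 : ℝ) ^ (1 / 3 : ℝ) * (k ^ 2)⁻¹ *
        (7 * Real.pi - (2 : ℝ) ^ (3 / 2 : ℝ) - 7 * Real.arccos (1 / 3))) := by
  have e1 : (2 : ℝ) ^ (7 / 6 : ℝ) = 2 * (2 : ℝ) ^ (1 / 6 : ℝ) := by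
    rw [show (7 / 6 : ℝ) = 1 + 1 / 6 by norm_num, Real.rpow_add two_pos, Real.rpow_one]
  have e2 : (3 : ℝ) ^ (-(2 / 3) : ℝ) = (3 : ℝ) ^ (1 / 3 : ℝ) / 3 := by
    rw [show (-(2 / 3) : ℝ) = 1 / 3 - 1 by norm_num, Real.rpow_sub_one (by norm_num)]
  have e3 : (2 : ℝ) ^ (3 / 2 : ℝ) = 2 * Real.sqrt 2 := by
    rw [show (3 / 2 : ℝ) = 1 + 1 / 2 by norm_num, Real.rpow_add two_pos, Real.rpow_one,
      Real.sqrt_eq_rpow]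
  have hθ := pi_sub_arccos_bound
  have hs := sqrt_two_lt
  have hs0 : 0 < Real.sqrt 2 := by positivity
  rw [e1, e2, e3]
  have hC : 0 < (2 : ℝ) ^ (1 / 6 : ℝ) * (3 : ℝ) ^ (1 / 3 : ℝ) * (k ^ 2)⁻¹ := by positivity
  obtain ⟨C, hCdef⟩ : ∃ C, C = (2 : ℝ) ^ (1 / 6 : ℝ) * (3 : ℝ) ^ (1 / 3 : ℝ) * (k ^ 2)⁻¹ :=
    ⟨_, rfl⟩
  have ha : 2 * (2 : ℝ) ^ (1 / 6 : ℝ) * ((3 : ℝ) ^ (1 / 3 : ℝ) / 3) * (k ^ 2)⁻¹ *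
      (2 * Real.sqrt 2 + 9 * Real.pi - 9 * Real.arccos (1 / 3)) =
      C * ((4 * Real.sqrt 2 + 18 * (Real.pi - Real.arccos (1 / 3))) / 3) := by
    rw [hCdef]; ring
  have hb : 2 * (2 : ℝ) ^ (1 / 6 : ℝ) * (3 : ℝ) ^ (1 / 3 : ℝ) * (k ^ 2)⁻¹ *
      (7 * Real.pi - 2 * Real.sqrt 2 - 7 * Real.arccos (1 / 3)) =
      C * (14 * (Real.pi - Real.arccos (1 / 3)) - 4 * Real.sqrt 2) := by
    rw [hCdef]; ring
  have hU : volumeFactor (equalLength k) / k = C := by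
    rw [volumeFactor_equalLength hk, hCdef]
    field_simp
  rw [← hCdef] at hC
  have h := hasSecondOrder_VEHR hk
  rw [hU] at h
  rw [ha, hb]
  refine h.hasHessianEigendata (contDiffAt_VEHR_equalLength hk) (by ring) (by ring) (by ring)
    (mul_pos hC (by linarith)).ne' (mul_pos hC (by linarith)).ne' fun heq => ?_
  have := mul_left_cancel₀ hC.ne' heq
  linarith

/-! ### Scale invariance and local minimality of VEHR -/

theorem len_smul (c : ℝ) (ℓ : Fin 6 → ℝ) (i j : Fin 4) : len (c • ℓ) i j = c * len ℓ i j := by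
  simp [len]

theorem faceAngle_smul {c : ℝ} (hc : c ≠ 0) (ℓ : Fin 6 → ℝ) (i j k : Fin 4) :
    faceAngle (c • ℓ) i j k = faceAngle ℓ i j k := by
  simp only [faceAngle, len_smul]
  rw [← mul_div_mul_left (len ℓ i j ^ 2 + len ℓ i k ^ 2 - len ℓ j k ^ 2)
    (2 * len ℓ i j * len ℓ i k) (pow_ne_zero 2 hc)]
  ring_nf

theorem dihedral_smul {c : ℝ} (hc : c ≠ 0) (ℓ : Fin 6 → ℝ) (e : Fin 6) :
    dihedral (c • ℓ) e = dihedral ℓ e := by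
  simp only [dihedral, dihedralAt, faceAngle_smul hc]

/-- The volume normalized functional is scale invariant. -/
theorem VEHR_smul {c : ℝ} (hc : 0 < c) (ℓ : Fin 6 → ℝ) : VEHR (c • ℓ) = VEHR ℓ := by
  have h1 : EHR (c • ℓ) = c * EHR ℓ := by
    simp only [EHR, edgeCurvature_eq, dihedral_smul hc.ne', Finset.mul_sum, Pi.smul_apply,
      smul_eq_mul]
    exact Finset.sum_congr rfl fun e _ => by ring
  have h2 : volume (c • ℓ) = c ^ 3 * volume ℓ := by
    have : cayleyMenger (c • ℓ) / 288 = (c ^ 3) ^ 2 * (cayleyMenger ℓ / 288) := by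
      simp only [cayleyMenger_eq, Pi.smul_apply, smul_eq_mul]
      ring
    rw [volume_eq, volume_eq, this, Real.sqrt_mul (by positivity), Real.sqrt_sq (by positivity)]
    ring
  have h3 : (c ^ 3) ^ (1 / 3 : ℝ) = c := by
    rw [← Real.rpow_natCast, ← Real.rpow_mul hc.le]
    norm_num
  have h4 : 0 ≤ volume ℓ := by
    rw [volume_eq]
    positivity
  rw [VEHR, VEHR, h1, h2, Real.mul_rpow (by positivity) h4, h3, mul_div_mul_left _ _ hc.ne']

/-- The Hessian is degenerate along scaling, so the second derivative test is applied only on the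
slice of total length 6k; rescaling carries nearby metrics to that slice without changing VEHR. -/
theorem isLocalMinOn_VEHR_equalLength {k : ℝ} (hk : 0 < k) :
    IsLocalMinOn VEHR met (equalLength k) := by
  have hnd := isNondegenerate_equalLength hk
  have hC : 0 < volumeFactor (equalLength k) / k := by
    rw [volumeFactor_equalLength hk]
    positivity
  have hθ := pi_sub_arccos_bound
  have hs := sqrt_two_lt
  have hs0 : 0 < Real.sqrt 2 := by positivity
  have hle := (hasSecondOrder_VEHR hk).eventually_le
    (by rw [← mul_sub]; exact mul_pos hC (by linarith))
    (by rw [← mul_add]; exact mul_pos hC (by linarith))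
  have hcont : ContinuousAt (fun ℓ : Fin 6 → ℝ => (6 * k * (totalLength ℓ)⁻¹) • ℓ)
      (equalLength k) :=
    (continuousAt_const.mul ((hasFDerivAt_totalLength _).continuousAt.inv₀
      hnd.totalLength_pos.ne')).smul continuousAt_id
  have hfix : (6 * k * (totalLength (equalLength k))⁻¹) • equalLength k = equalLength k := by
    rw [totalLength_equalLength, mul_inv_cancel₀ (by positivity), one_smul]
  have hev := hcont.eventually (p := fun m => ∑ e, m e = ∑ e, equalLength k e →
    VEHR (equalLength k) ≤ VEHR m) (by beta_reduce; rw [hfix]; exact hle)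
  filter_upwards [nhdsWithin_le_nhds hev, self_mem_nhdsWithin] with ℓ h1 h2
  have hL := (mem_met_iff.1 h2).totalLength_pos
  have h3 := h1 ?_
  · rwa [VEHR_smul (by positivity)] at h3
  · change _ = totalLength (equalLength k)
    rw [totalLength_equalLength]
    simp only [Pi.smul_apply, smul_eq_mul, ← Finset.mul_sum]
    change 6 * k * (totalLength ℓ)⁻¹ * totalLength ℓ = _
    field_simp

end DoubleTetrahedron

end

theorem theorem3p2 :
    (∀ k : ℝ, 0 < k →
      DoubleTetrahedron.IsLEinstein (DoubleTetrahedron.equalLength k) ∧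
      DoubleTetrahedron.IsVEinstein (DoubleTetrahedron.equalLength k)) ∧
    (∀ k : ℝ, 0 < k →
      DoubleTetrahedron.HasHessianEigendata DoubleTetrahedron.LEHR
        (DoubleTetrahedron.equalLength k)
        (2 * Real.sqrt 2 / 9 * (k ^ 2)⁻¹)
        (-(2 * Real.sqrt 2 / 3) * (k ^ 2)⁻¹) ∧
      DoubleTetrahedron.HasHessianEigendata DoubleTetrahedron.VEHR
        (DoubleTetrahedron.equalLength k)
        ((2 : ℝ) ^ (7 / 6 : ℝ) * (3 : ℝ) ^ (-(2 / 3) : ℝ) * (k ^ 2)⁻¹ *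
          ((2 : ℝ) ^ (3 / 2 : ℝ) + 9 * Real.pi - 9 * Real.arccos (1 / 3)))
        ((2 : ℝ) ^ (7 / 6 : ℝ) * (3 : ℝ) ^ (1 / 3 : ℝ) * (k ^ 2)⁻¹ *
          (7 * Real.pi - (2 : ℝ) ^ (3 / 2 : ℝ) - 7 * Real.arccos (1 / 3)))) ∧
    ((∀ ℓ : Fin 6 → ℝ, DoubleTetrahedron.IsCritical DoubleTetrahedron.LEHR ℓ ↔
        ∃ k : ℝ, 0 < k ∧ ℓ = DoubleTetrahedron.equalLength k) ∧
      (∀ ℓ : Fin 6 → ℝ, DoubleTetrahedron.IsLEinstein ℓ ↔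
        ∃ k : ℝ, 0 < k ∧ ℓ = DoubleTetrahedron.equalLength k) ∧
      (∀ k : ℝ, 0 < k →
        DoubleTetrahedron.IsSaddle DoubleTetrahedron.LEHR (DoubleTetrahedron.equalLength k))) ∧
    (∀ k : ℝ, 0 < k →
      IsLocalMinOn DoubleTetrahedron.VEHR DoubleTetrahedron.met
        (DoubleTetrahedron.equalLength k)) := by
  exact ⟨fun k hk => ⟨DoubleTetrahedron.isLEinstein_equalLength hk,
      DoubleTetrahedron.isVEinstein_equalLength hk⟩,
    fun k hk => ⟨DoubleTetrahedron.hasHessianEigendata_LEHR hk,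
      DoubleTetrahedron.hasHessianEigendata_VEHR hk⟩,
    ⟨DoubleTetrahedron.isCritical_LEHR_iff, DoubleTetrahedron.isLEinstein_iff,
      fun k hk => DoubleTetrahedron.isSaddle_LEHR_equalLength hk⟩,
    fun k hk => DoubleTetrahedron.isLocalMinOn_VEHR_equalLength hk⟩
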